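/- **Setting.** Let $M\ge 3$ be an integer, $a>0$, $\mu\in\mathbb R$, $g\in\mathbb R\setminus\{0\}$, and $\alpha>0$ with $\alpha\ne \frac1{2a}$. Write $z^*$ for the complex conjugate of $z$, and for $0\le k,m\le M-1$ put $$\theta_m=\frac{2\pi m}{M},\qquad \Delta_{km}=\theta_k-\theta_m,\qquad \Gamma_m(t,\theta)=g\,t^{2\mu-1}e^{2a(\theta-\theta_m)} .$$ *Finite part.* For a function $F$ on $\mathbb R\setminus\{0\}$, integrable on compact subintervals of $\mathbb R\setminus\{0\}$, and $r<0<R$ let $$\mathrm{f.p.}\!\int_r^R F(\sigma)\,d\sigma=\lim_{\varepsilon\to0^+}\Big(\int_r^{-\varepsilon}F\,d\sigma+\int_{\varepsilon}^{R}F\,d\sigma-\varepsilon F(\varepsilon)-\varepsilon F(-\varepsilon)\Big),$$ and let $\mathrm{f.p.}\int_{-\infty}^{\infty}F\,d\sigma$ be the limit of $\mathrm{f.p.}\int_r^RF\,d\sigma$ as $r\to-\infty$, $R\to\infty$. *Linearized Birkhoff–Rott equation.* A family $\zeta=(\zeta_0,\dots,\zeta_{M-1})$ of functions $\zeta_m(t,\theta)$,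 $t>0$, $\theta\in\mathbb R$, differentiable in $t$ and in $\theta$, satisfies this equation if for all $m$, all $t>0$ and all $\theta\in\mathbb R$ $$t\,\partial_t\zeta_m(t,\theta)^*-\frac{2\mu-1}{2a}\,\partial_\theta\zeta_m(t,\theta)^*=-\mathcal H_m\zeta(t,\theta),$$ $$\mathcal H_m\zeta(t,\theta)=\frac{ag}{\pi i}\,\mathrm{f.p.}\!\int_{-\infty}^{\infty}\sum_{k=0}^{M-1}\frac{\big(\zeta_m(t,\theta)-\zeta_k(t,\sigma+\theta+\Delta_{km})\big)e^{2a\sigma}e^{-2i\theta}}{\big(1-e^{(a+i)\sigma}e^{i\Delta_{km}}\big)^2}\,d\sigma ,$$ where the existence of the finite part integrals is part of the requirement. *Ansatz.* For smooth functions $X_m,Y_m:(0,\infty)\to\mathbb C$, $0\le m\le M-1$, let $$\zeta_m(t,\theta)=X_m(t)\,\zeta_m^+(t,\theta)\,e^{i\theta}+Y_m(t)\,\zeta_m^-(t,\theta)\,e^{i\theta},\qquad \zeta_m^\pm(t,\theta)=e^{\pm i\alpha\ln(\Gamma_m(t,\theta)/g)} .$$ *Coefficients.* Let $$A=-\frac{2ai}{a+i},\qquad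 B_\pm=-a(\pm2i\alpha+1)\frac{1+ai}{1+a^2},\qquad c_0=\frac{ga(a-i)}{(a+i)^2}\coth\frac{\pi A}{M},$$ $$c_{mk}^\pm(\alpha)=\frac{a^2(\pm2i\alpha+1)}{(a+i)^2}\,\frac{\mathcal B_{mk}^\pm}{\sinh(\pi B_\pm)},\qquad \mathcal B_{mk}^\pm=e^{\Delta_{km}B_\pm}\cdot\begin{cases}e^{-\pi B_\pm},&\Delta_{km}>0,\\ \cosh(\pi B_\pm),&\Delta_{km}=0,\\ e^{\pi B_\pm},&\Delta_{km}<0.\end{cases}$$ **Proposition 1.2 (ODE characterization).** Suppose that for all $t>0$ $$\sum_{k=0}^{M-1}X_k(t)e^{-i\theta_k}=\sum_{k=0}^{M-1}Y_k(t)e^{-i\theta_k}=0,\qquad \sum_{k=0}^{M-1}X_k(t)e^{-2i\theta_k}=\sum_{k=0}^{M-1}Y_k(t)e^{-2i\theta_k}=0 .$$ Then $\zeta$ satisfies the linearized Birkhoff–Rott equation if and only if for all $m=0,\dots,M-1$ and all $t>0$ $$\begin{aligned} t\,X_m'(t)+i\,\frac{1-2\mu}{2a}X_m(t)&=-c_0^*\,Y_m(t)^*+g\sum_{k=0}^{M-1}c_{mk}^-(\alpha)^*\,Y_k(t)^*,\\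 t\,Y_m'(t)+i\,\frac{1-2\mu}{2a}Y_m(t)&=-c_0^*\,X_m(t)^*+g\sum_{k=0}^{M-1}c_{mk}^+(\alpha)^*\,X_k(t)^* . \end{aligned}$$ -/

import Mathlib

open Filter Topology MeasureTheory
open scoped ComplexConjugate ContDiff

noncomputable section

namespace AlexanderSpiral

/-! ### Finite part integrals -/

/-- `HasFinitePart F x a b L`: the Hadamard finite part of `∫ F` over `[a, b]`, where `F` is allowed
a double pole type singularity at the interior point `x`, exists and equals `L`:
`L = lim_{ε → 0⁺} (∫_a^{x-ε} F + ∫_{x+ε}^b F - ε F(x+ε) - ε F(x-ε))`.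
For `F t = f t / (t - x)²` the correction term is `-(f (x+ε) + f (x-ε)) / ε`, and for
`F t = f t / (γ t - γ x)²` this is the finite part along the curve `γ`
(see `hasFinitePart_div_sq_iff` and `hasFinitePart_curve_iff`). -/
def HasFinitePart (F : ℝ → ℂ) (x a b : ℝ) (L : ℂ) : Prop :=
  (∀ ε : ℝ, 0 < ε → ε < x - a → ε < b - x →
    IntervalIntegrable F volume a (x - ε) ∧ IntervalIntegrable F volume (x + ε) b) ∧
  Tendsto (fun ε : ℝ =>
      (∫ t in a..(x - ε), F t) + (∫ t in (x + ε)..b, F t)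
        - (ε : ℂ) * F (x + ε) - (ε : ℂ) * F (x - ε))
    (𝓝[>] 0) (𝓝 L)

/-- The finite part of `f t / (t - x)²` is the classical one of Hadamard. -/
theorem hasFinitePart_div_sq_iff (f : ℝ → ℂ) (x a b : ℝ) (L : ℂ) :
    HasFinitePart (fun t => f t / ((t : ℂ) - x) ^ 2) x a b L ↔
      (∀ ε : ℝ, 0 < ε → ε < x - a → ε < b - x →
        IntervalIntegrable (fun t => f t / ((t : ℂ) - x) ^ 2) volume a (x - ε) ∧
        IntervalIntegrable (fun t => f t / ((t : ℂ) - x) ^ 2) volume (x + ε) b) ∧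
      Tendsto (fun ε : ℝ =>
          (∫ t in a..(x - ε), f t / ((t : ℂ) - x) ^ 2)
            + (∫ t in (x + ε)..b, f t / ((t : ℂ) - x) ^ 2)
            - (f (x + ε) + f (x - ε)) / (ε : ℂ))
        (𝓝[>] 0) (𝓝 L) := by
  unfold HasFinitePart
  refine and_congr_right fun _ => tendsto_congr' ?_
  filter_upwards [self_mem_nhdsWithin] with ε hε
  have hne : (ε : ℂ) ≠ 0 := by exact_mod_cast (ne_of_gt hε)
  push_cast
  have h1 : (x : ℂ) + ε - x = ε := by ring
  have h2 : (x : ℂ) - ε - x = -ε := by ring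
  rw [h1, h2]
  field_simp
  ring

/-- The finite part of `f t / (γ t - γ x)²` is the finite part of `g t / (t - x)²`, where
`g t = f t ((γ t - γ x) / (t - x))⁻²`. -/
theorem hasFinitePart_curve_iff (f γ : ℝ → ℂ) (x a b : ℝ) (L : ℂ) :
    HasFinitePart (fun t => f t / (γ t - γ x) ^ 2) x a b L ↔
      HasFinitePart
        (fun t => (f t * (((γ t - γ x) / ((t : ℂ) - x)) ^ 2)⁻¹) / ((t : ℂ) - x) ^ 2) x a b L := by
  have h : (fun t => f t / (γ t - γ x) ^ 2) =
      fun t : ℝ => (f t * (((γ t - γ x) / ((t : ℂ) - x)) ^ 2)⁻¹) / ((t : ℂ) - x) ^ 2 := by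
    funext t
    by_cases ht : (t : ℂ) - x = 0
    · have ht' : t = x := by exact_mod_cast sub_eq_zero.mp ht
      simp [ht']
    · by_cases hγ : γ t - γ x = 0
      · simp [hγ]
      · field_simp
  rw [h]

/-- `HasFinitePartLine F x L`: the improper finite part integral `f.p. ∫_{-∞}^{∞} F`, with
singularity at `x`, converges to `L`. The finite part exists on each bounded interval `[a, b]`
around `x`, and these tend to `L` as `a → -∞` and `b → ∞` independently. -/
def HasFinitePartLine (F : ℝ → ℂ) (x : ℝ) (L : ℂ) : Prop :=
  ∃ I : ℝ → ℝ → ℂ,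
    (∀ a b : ℝ, a < x → x < b → HasFinitePart F x a b (I a b)) ∧
    Tendsto (fun p : ℝ × ℝ => I p.1 p.2) (atBot ×ˢ atTop) (𝓝 L)

/-! ### The Alexander spiral and the linearized Birkhoff-Rott equation -/

/-- The angles `θ_m = 2πm/M`. -/
def angle (M : ℕ) (m : Fin M) : ℝ := 2 * Real.pi * (m : ℝ) / M

/-- `Δ_{km} = θ_k - θ_m`. -/
def angleDiff (M : ℕ) (k m : Fin M) : ℝ := angle M k - angle M m

/-- The circulation `Γ_m(t, θ) = g t^{2μ-1} e^{2a(θ - θ_m)}`. -/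
def circulation (a μ g : ℝ) (M : ℕ) (m : Fin M) (t θ : ℝ) : ℝ :=
  g * t ^ (2 * μ - 1) * Real.exp (2 * a * (θ - angle M m))

/-- The integrand of the operator `H_m`, applied to `ζ = (ζ_0, …, ζ_{M-1})` at `θ`:
`∑_k (ζ_m(θ) - ζ_k(σ + θ + Δ_{km})) e^{2aσ} e^{-2iθ} / (1 - e^{(a+i)σ} e^{iΔ_{km}})²`. -/
def linBRIntegrand (a : ℝ) (M : ℕ) (ζ : Fin M → ℝ → ℂ) (m : Fin M) (θ σ : ℝ) : ℂ :=
  ∑ k : Fin M,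
    (ζ m θ - ζ k (σ + θ + angleDiff M k m))
        * Complex.exp (2 * a * σ) * Complex.exp (-2 * Complex.I * θ)
      / (1 - Complex.exp ((a + Complex.I) * σ) * Complex.exp (Complex.I * angleDiff M k m)) ^ 2

/-- `HasLinBROperator a g M ζ m θ h`: the finite part integral which defines `H_m ζ(θ)` converges,
and `H_m ζ(θ) = h`. -/
def HasLinBROperator (a g : ℝ) (M : ℕ) (ζ : Fin M → ℝ → ℂ) (m : Fin M) (θ : ℝ) (h : ℂ) : Prop :=
  ∃ L : ℂ, HasFinitePartLine (linBRIntegrand a M ζ m θ) 0 L ∧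
    h = (a * g : ℂ) / (Real.pi * Complex.I) * L

/-- `ζ_m(t, θ)` solves the linearized Birkhoff-Rott equation
`t ∂_t ζ_m^* - (2μ-1)/(2a) ∂_θ ζ_m^* = -H_m ζ` for all `m`, `t > 0` and `θ`. -/
def SolvesLinearizedBR (a μ g : ℝ) (M : ℕ) (ζ : Fin M → ℝ → ℝ → ℂ) : Prop :=
  ∀ (m : Fin M) (t : ℝ), 0 < t → ∀ θ : ℝ,
    DifferentiableAt ℝ (fun s => ζ m s θ) t ∧
    DifferentiableAt ℝ (fun φ => ζ m t φ) θ ∧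
    ∃ h : ℂ, HasLinBROperator a g M (fun k φ => ζ k t φ) m θ h ∧
      (t : ℂ) * deriv (fun s => conj (ζ m s θ)) t
          - ((2 * μ - 1) / (2 * a) : ℂ) * deriv (fun φ => conj (ζ m t φ)) θ
        = -h

/-! ### The ansatz

The sign `±` is a real argument `s`, equal to `1` or `-1`. -/

/-- `ζ_m^±(t, θ) = e^{± iα ln(Γ_m(t, θ)/g)}`. -/
def mode (s a μ g α : ℝ) (M : ℕ) (m : Fin M) (t θ : ℝ) : ℂ :=
  Complex.exp (s * Complex.I * α * Real.log (circulation a μ g M m t θ / g))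

/-- The logarithm in the modes, written out. -/
theorem mode_eq (s a μ g α : ℝ) (hg : g ≠ 0) (M : ℕ) (m : Fin M) (t θ : ℝ) (ht : 0 < t) :
    mode s a μ g α M m t θ =
      Complex.exp (s * Complex.I * α *
        ((2 * a * (θ - angle M m) + (2 * μ - 1) * Real.log t : ℝ) : ℂ)) := by
  have h : circulation a μ g M m t θ / g =
      t ^ (2 * μ - 1) * Real.exp (2 * a * (θ - angle M m)) := by
    unfold circulation
    field_simp
  unfold mode
  rw [h, Real.log_mul (Real.rpow_pos_of_pos ht _).ne' (Real.exp_pos _).ne', Real.log_rpow ht,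
    Real.log_exp, add_comm]

/-- The perturbation `ζ_m = X_m ζ_m^+ e^{iθ} + Y_m ζ_m^- e^{iθ}`. -/
def ansatz (a μ g α : ℝ) (M : ℕ) (X Y : Fin M → ℝ → ℂ) (m : Fin M) (t θ : ℝ) : ℂ :=
  X m t * mode 1 a μ g α M m t θ * Complex.exp (Complex.I * θ)
    + Y m t * mode (-1) a μ g α M m t θ * Complex.exp (Complex.I * θ)

/-! ### The coefficients -/

/-- `A = -2ai/(a+i)`. -/
def coeffA (a : ℝ) : ℂ := -(2 * a * Complex.I / (a + Complex.I))

/-- `B_± = -a (± 2iα + 1) (1 + ai)/(1 + a²)`. -/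
def coeffB (s a α : ℝ) : ℂ :=
  -a * (s * 2 * Complex.I * α + 1) * ((1 + a * Complex.I) / (1 + a ^ 2))

/-- `c_0 = g a (a - i)/(a + i)² coth(πA/M)`. -/
def c0 (a g : ℝ) (M : ℕ) : ℂ :=
  g * a * (a - Complex.I) / (a + Complex.I) ^ 2
    * (Complex.cosh (Real.pi * coeffA a / M) / Complex.sinh (Real.pi * coeffA a / M))

/-- `ℬ_{mk}^±(α)`, which is `e^{Δ_{km} B_±}` times `e^{-πB_±}`, `cosh(πB_±)` or `e^{πB_±}` as
`Δ_{km}` is positive, zero or negative. -/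
def calB (s a α : ℝ) (M : ℕ) (m k : Fin M) : ℂ :=
  Complex.exp (angleDiff M k m * coeffB s a α) *
    if 0 < angleDiff M k m then Complex.exp (-Real.pi * coeffB s a α)
    else if angleDiff M k m = 0 then Complex.cosh (Real.pi * coeffB s a α)
    else Complex.exp (Real.pi * coeffB s a α)

/-- `c_{mk}^±(α) = a² (± 2iα + 1)/(a + i)² · ℬ_{mk}^±(α) / sinh(πB_±)`. -/
def cmk (s a α : ℝ) (M : ℕ) (m k : Fin M) : ℂ :=
  a ^ 2 * (s * 2 * Complex.I * α + 1) / (a + Complex.I) ^ 2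
    * (calB s a α M m k / Complex.sinh (Real.pi * coeffB s a α))

end AlexanderSpiral

end

open AlexanderSpiral

noncomputable section

namespace AlexanderSpiral

/-! ### Calculus of finite parts -/

/-! Everything reduces to the kernel `K(z) = e^{βz} / (1 - e^{cz})²` with `c = a + i` and `Re β =
2a`. A shift along the spiral multiplies each mode by an exponential in `σ`, so inserting the ansatz
into `H_m` leaves only such kernels: `β = 2a` for the terms with `ζ_m(θ)` and `β = 2a + i ± 2iαa`
for the two modes. A pole at angle `Δ` becomes a translation, because `e^{cσ} e^{iΔ} = e^{c(σ - z)}`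
for `z = -iΔ/c`.

At `-∞` the kernel decays; at `+∞` it behaves like `e^{(β - 2c)z}`, which is bounded without decay.
Once the primitive of this tail is subtracted, integrals along horizontal lines in the strip around
the pole at `0` converge, with limits that depend only on the side of the pole. The two sides differ
from the finite part by plus or minus the half residue `κ = πi(β - c)/c²`
(`exists_expKernel_comparison`). The quasi-period `p = 2πi/c` multiplies `K` by `e^{βp} = e^{-2πB}`,
where `B = -iβ/c`, and relates the lines on the two sides: the regularized finite part `N` satisfies
`N - κ = e^{-2πB}(N + κ)`, hence `N = κ coth πB`. This yields the three-case weight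
(`exists_rotatedKernel_finitePart`).

In the sum over branches the tails cancel: through `∑ e^{-2iΔ_{km}} = 0` for the `ζ_m(θ)` terms,
since `M ≥ 3`, and through the first moment condition for the modes, whose factor `e^{iΔ_{km}}`
lowers the frequency by one. The condition `β ≠ 2c` excludes a constant tail; for the modes this is
`α ≠ 1/(2a)`. The weights of the `ζ_m(θ)` terms add up to `coth(πA/M)` by geometric summation.

Thus `H_m` has an explicit form on the ansatz (`hasLinBROperator_ansatz_iff`). The transport part of
the equation cancels the `α`-dependent derivatives, conjugation exchanges the two modes, and their
linear independence in `θ` separates the equation into the two stated ones. -/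

theorem eventually_small_nhdsGT_zero {r : ℝ} (hr : 0 < r) : ∀ᶠ ε : ℝ in 𝓝[>] 0, 0 < ε ∧ ε < r :=
  Ioo_mem_nhdsGT hr

theorem HasFinitePart.unique {F : ℝ → ℂ} {x a b : ℝ} {L L' : ℂ} (h : HasFinitePart F x a b L)
    (h' : HasFinitePart F x a b L') : L = L' :=
  tendsto_nhds_unique h.2 h'.2

theorem HasFinitePart.add {F G : ℝ → ℂ} {x a b : ℝ} {L K : ℂ} (hax : a < x) (hxb : x < b)
    (hF : HasFinitePart F x a b L) (hG : HasFinitePart G x a b K) :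
    HasFinitePart (fun t => F t + G t) x a b (L + K) := by
  refine ⟨fun ε h0 h1 h2 => ⟨(hF.1 ε h0 h1 h2).1.add (hG.1 ε h0 h1 h2).1,
    (hF.1 ε h0 h1 h2).2.add (hG.1 ε h0 h1 h2).2⟩, (hF.2.add hG.2).congr' ?_⟩
  filter_upwards [eventually_small_nhdsGT_zero (sub_pos.2 hax),
    eventually_small_nhdsGT_zero (sub_pos.2 hxb)] with ε h1 h2
  rw [intervalIntegral.integral_add (hF.1 ε h1.1 h1.2 h2.2).1 (hG.1 ε h1.1 h1.2 h2.2).1,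
    intervalIntegral.integral_add (hF.1 ε h1.1 h1.2 h2.2).2 (hG.1 ε h1.1 h1.2 h2.2).2]
  ring

theorem HasFinitePart.const_mul {F : ℝ → ℂ} {x a b : ℝ} {L : ℂ} (w : ℂ)
    (hF : HasFinitePart F x a b L) : HasFinitePart (fun t => w * F t) x a b (w * L) := by
  refine ⟨fun ε h0 h1 h2 => ⟨(hF.1 ε h0 h1 h2).1.const_mul w, (hF.1 ε h0 h1 h2).2.const_mul w⟩,
    (hF.2.const_mul w).congr fun ε => ?_⟩
  rw [intervalIntegral.integral_const_mul, intervalIntegral.integral_const_mul]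
  ring

theorem hasFinitePart_zero (x a b : ℝ) : HasFinitePart (fun _ => 0) x a b 0 :=
  ⟨fun _ _ _ _ => ⟨by simp, by simp⟩, by simp⟩

theorem HasFinitePart.sum {ι : Type*} (s : Finset ι) {F : ι → ℝ → ℂ} {x a b : ℝ} {L : ι → ℂ}
    (hax : a < x) (hxb : x < b) (h : ∀ i ∈ s, HasFinitePart (F i) x a b (L i)) :
    HasFinitePart (fun t => ∑ i ∈ s, F i t) x a b (∑ i ∈ s, L i) := by
  classical
  induction s using Finset.induction_on with
  | empty => simpa using hasFinitePart_zero x a b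
  | insert i s hi ih =>
    simp only [Finset.sum_insert hi]
    exact (h i (Finset.mem_insert_self i s)).add hax hxb
      (ih fun j hj => h j (Finset.mem_insert_of_mem hj))

theorem HasFinitePartLine.unique {F : ℝ → ℂ} {x : ℝ} {L L' : ℂ} (h : HasFinitePartLine F x L)
    (h' : HasFinitePartLine F x L') : L = L' := by
  obtain ⟨I, hI, hL⟩ := h
  obtain ⟨J, hJ, hL'⟩ := h'
  refine tendsto_nhds_unique hL (hL'.congr' ?_)
  filter_upwards [prod_mem_prod (Iio_mem_atBot x) (Ioi_mem_atTop x)] with p hp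
  exact (hJ _ _ hp.1 hp.2).unique (hI _ _ hp.1 hp.2)

/-- The finite part of a function with a double pole at `0`, by the fundamental theorem of
calculus. -/
theorem hasFinitePart_of_laurent {F P q : ℝ → ℂ} {c₁ c₂ : ℂ} (hP : ∀ t, HasDerivAt P (q t) t)
    (hq : Continuous q) (hF : ∀ t : ℝ, t ≠ 0 → F t = c₂ / t ^ 2 + c₁ / t + q t)
    {a b : ℝ} (ha : a < 0) (hb : 0 < b) :
    HasFinitePart F 0 a b
      ((P b - c₂ / b + c₁ * Real.log b) - (P a - c₂ / a + c₁ * Real.log a)) := by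
  have hG : ∀ t : ℝ, t ≠ 0 →
      HasDerivAt (fun s : ℝ => P s - c₂ / s + c₁ * Real.log s) (F t) t := by
    intro t ht
    have ht' : (t : ℂ) ≠ 0 := by exact_mod_cast ht
    have h1 := ((hasDerivAt_id t).ofReal_comp.inv ht').const_mul c₂
    have h2 := (Real.hasDerivAt_log ht).ofReal_comp.const_mul c₁
    refine (((hP t).sub h1).add h2).congr_deriv ?_
    rw [hF t ht, id]
    push_cast
    field_simp
    ring
  have hcont : ContinuousOn F {0}ᶜ := by
    have : ContinuousOn (fun t : ℝ => c₂ / (t : ℂ) ^ 2 + c₁ / t + q t) {0}ᶜ := by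
      have hne : ∀ t ∈ ({0}ᶜ : Set ℝ), (t : ℂ) ≠ 0 := fun t ht => by simpa using ht
      refine ((continuousOn_const.div (by fun_prop) fun t ht => pow_ne_zero 2 (hne t ht)).add
        (continuousOn_const.div (by fun_prop) hne)).add hq.continuousOn
    exact this.congr fun t ht => hF t ht
  have hint : ∀ u v : ℝ, (0 : ℝ) ∉ Set.uIcc u v → IntervalIntegrable F volume u v :=
    fun u v h => (hcont.mono fun t ht => by rintro rfl; exact h ht).intervalIntegrable
  have hint1 : ∀ ε : ℝ, 0 < ε → (0 : ℝ) ∉ Set.uIcc a (0 - ε) := fun ε h0 h => by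
    rcases Set.mem_uIcc.1 h with h | h <;> linarith [h.1, h.2]
  have hint2 : ∀ ε : ℝ, 0 < ε → (0 : ℝ) ∉ Set.uIcc (0 + ε) b := fun ε h0 h => by
    rcases Set.mem_uIcc.1 h with h | h <;> linarith [h.1, h.2]
  refine ⟨fun ε h0 h1 h2 => ⟨hint _ _ (hint1 ε h0), hint _ _ (hint2 ε h0)⟩, ?_⟩
  have hPc : Continuous P := continuous_iff_continuousAt.2 fun t => (hP t).continuousAt
  -- In the cut-off integral the even function `log |t|` cancels between `ε` and `-ε`, and the terms
  -- `2c₂/ε` are removed by the correction `εF(ε) + εF(-ε)`, where `c₁` drops out. Only vanishing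
  -- terms in `P` and `q` remain.
  have hlim : Tendsto (fun ε : ℝ =>
      ((P b - c₂ / b + c₁ * Real.log b) - (P a - c₂ / a + c₁ * Real.log a))
        + (P (-ε) - P ε) - ε * (q ε + q (-ε))) (𝓝[>] 0)
      (𝓝 ((P b - c₂ / b + c₁ * Real.log b) - (P a - c₂ / a + c₁ * Real.log a))) := by
    have : Continuous (fun ε : ℝ =>
      ((P b - c₂ / b + c₁ * Real.log b) - (P a - c₂ / a + c₁ * Real.log a))
        + (P (-ε) - P ε) - ε * (q ε + q (-ε))) := by fun_prop
    simpa using (this.tendsto 0).mono_left nhdsWithin_le_nhds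
  refine hlim.congr' ?_
  filter_upwards [self_mem_nhdsWithin] with ε (hε : 0 < ε)
  rw [intervalIntegral.integral_eq_sub_of_hasDerivAt
      (fun t ht => hG t (by rintro rfl; exact hint1 ε hε ht)) (hint _ _ (hint1 ε hε)),
    intervalIntegral.integral_eq_sub_of_hasDerivAt
      (fun t ht => hG t (by rintro rfl; exact hint2 ε hε ht)) (hint _ _ (hint2 ε hε)),
    zero_sub, zero_add, hF ε hε.ne', hF (-ε) (neg_ne_zero.2 hε.ne'), Real.log_neg_eq_log]
  have : (ε : ℂ) ≠ 0 := by exact_mod_cast hε.ne'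
  have hneg : ((-ε : ℝ) : ℂ) = -ε := by push_cast; rfl
  rw [hneg]
  field_simp
  ring

theorem hasFinitePart_of_continuous {F : ℝ → ℂ} (hF : Continuous F) {a b : ℝ} (ha : a < 0)
    (hb : 0 < b) : HasFinitePart F 0 a b (∫ t in a..b, F t) := by
  have hP : ∀ t, HasDerivAt (fun u => ∫ s in (0 : ℝ)..u, F s) (F t) t :=
    fun t => hF.integral_hasStrictDerivAt 0 t |>.hasDerivAt
  have := hasFinitePart_of_laurent (F := F) (c₁ := 0) (c₂ := 0) hP hF (by simp) ha hb
  rw [intervalIntegral.integral_eq_sub_of_hasDerivAt (fun t _ => hP t) (hF.intervalIntegrable _ _)]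
  simpa using this

/-! ### The kernel `e^{βz} / (1 - e^{cz})²` -/

/-- The kernel `e^{βz} / (1 - e^{cz})²`. -/
def expKernel (c β z : ℂ) : ℂ := Complex.exp (β * z) / (1 - Complex.exp (c * z)) ^ 2

/-- The period `2πi/c` of `e^{cz}`. -/
def expPeriod (c : ℂ) : ℂ := 2 * Real.pi * Complex.I / c

/-- The horizontal strip of half width `Im (2πi/c)`, in which `0` is the only pole of the kernel. -/
def kernelStrip (c : ℂ) : Set ℂ := {z | |z.im| < (expPeriod c).im}

theorem expPeriod_im (c : ℂ) : (expPeriod c).im = 2 * Real.pi * c.re / Complex.normSq c := by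
  simp [expPeriod, Complex.div_im]

theorem expPeriod_im_pos {c : ℂ} (hc : 0 < c.re) : 0 < (expPeriod c).im := by
  have hc0 : c ≠ 0 := by rintro rfl; simp at hc
  rw [expPeriod_im]
  have := Complex.normSq_pos.2 hc0
  positivity

theorem isOpen_kernelStrip (c : ℂ) : IsOpen (kernelStrip c) :=
  isOpen_lt (by fun_prop) continuous_const

theorem convex_kernelStrip (c : ℂ) : Convex ℝ (kernelStrip c) := by
  have : kernelStrip c = Complex.imLm ⁻¹' Set.Ioo (-(expPeriod c).im) (expPeriod c).im := by
    ext z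
    simp [kernelStrip, abs_lt]
  rw [this]
  exact (convex_Ioo _ _).linear_preimage _

theorem zero_mem_kernelStrip {c : ℂ} (hc : 0 < c.re) : (0 : ℂ) ∈ kernelStrip c := by
  simpa [kernelStrip] using expPeriod_im_pos hc

theorem ofReal_mem_kernelStrip {c : ℂ} (hc : 0 < c.re) (t : ℝ) : (t : ℂ) ∈ kernelStrip c := by
  simpa [kernelStrip] using expPeriod_im_pos hc

theorem ofReal_sub_mem_kernelStrip {c z : ℂ} (hz : z ∈ kernelStrip c) (t : ℝ) :
    (t : ℂ) - z ∈ kernelStrip c := by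
  simpa [kernelStrip] using hz

/-- The solutions of `e^{cz} = 1` are the integer multiples of the period, and the strip leaves room
only for the multiple `0`. -/
theorem exp_mul_ne_one {c z : ℂ} (hc : 0 < c.re) (hz : z ∈ kernelStrip c) (hz0 : z ≠ 0) :
    Complex.exp (c * z) ≠ 1 := by
  intro h
  have hc0 : c ≠ 0 := by rintro rfl; simp at hc
  obtain ⟨n, hn⟩ := Complex.exp_eq_one_iff.1 h
  have hzn : z = (n : ℝ) * expPeriod c := by
    unfold expPeriod
    field_simp
    push_cast
    linear_combination hn
  have him : z.im = n * (expPeriod c).im := by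
    rw [hzn, Complex.im_ofReal_mul]
  have hη := expPeriod_im_pos hc
  have hlt : |(n : ℝ)| < 1 := by
    have : |z.im| < (expPeriod c).im := hz
    rw [him, abs_mul, abs_of_pos hη] at this
    nlinarith
  have : n = 0 := by
    have : |n| < 1 := by exact_mod_cast hlt
    exact Int.abs_lt_one_iff.1 this
  apply hz0
  simp [hzn, this]

/-- The denominator is periodic, so only the numerator contributes a factor. This quasi-periodicity
later determines the value of the integral. -/
theorem expKernel_add_period {c : ℂ} (hc : 0 < c.re) (β z : ℂ) :
    expKernel c β (z + expPeriod c) = Complex.exp (β * expPeriod c) * expKernel c β z := by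
  have hc0 : c ≠ 0 := by rintro rfl; simp at hc
  have h : c * (z + expPeriod c) = c * z + 2 * Real.pi * Complex.I := by
    unfold expPeriod
    field_simp
  unfold expKernel
  rw [h, Complex.exp_add, Complex.exp_two_pi_mul_I, mul_add, Complex.exp_add]
  ring

/-- The Laurent expansion of the kernel at `0`, with a primitive of its regular part. -/
theorem exists_laurent_expKernel {c : ℂ} (hc : 0 < c.re) (β : ℂ) :
    ∃ P q : ℂ → ℂ, (∀ z ∈ kernelStrip c, HasDerivAt P (q z) z) ∧ ContinuousOn q (kernelStrip c) ∧
      ∀ z ∈ kernelStrip c, z ≠ 0 →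
        expKernel c β z = 1 / c ^ 2 / z ^ 2 + (β - c) / c ^ 2 / z + q z := by
  have hc0 : c ≠ 0 := by rintro rfl; simp at hc
  have hS : kernelStrip c ∈ 𝓝 (0 : ℂ) :=
    (isOpen_kernelStrip c).mem_nhds (zero_mem_kernelStrip hc)
  -- `E` is the entire extension of `(1 - e^{cz})/z`, so the kernel is `k(z)/z²` with `k =
  -- e^{βz}/E²` holomorphic in the strip. The regular part `q` is the second divided difference of
  -- `k` at `0`.
  set E : ℂ → ℂ := dslope (fun z => 1 - Complex.exp (c * z)) 0 with hE
  have hE_mul : ∀ z, 1 - Complex.exp (c * z) = z * E z := by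
    intro z
    have := sub_smul_dslope (fun z => 1 - Complex.exp (c * z)) 0 z
    simpa using this.symm
  have hexp : ∀ z, HasDerivAt (fun z => 1 - Complex.exp (c * z)) (-(c * Complex.exp (c * z))) z := by
    intro z
    have := (((hasDerivAt_id z).const_mul c).cexp).const_sub 1
    simpa [mul_comm] using this
  have hE0 : E 0 = -c := by
    rw [hE, dslope_same, (hexp 0).deriv]
    simp
  have hEd : Differentiable ℂ E := by
    rw [← differentiableOn_univ]
    exact (Complex.differentiableOn_dslope univ_mem).2
      fun z _ => (hexp z).differentiableAt.differentiableWithinAt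
  -- Differentiating `zE(z) = 1 - e^{cz}` twice at `0` gives `2E'(0) = -c²`.
  have hE' : deriv E 0 = -(c ^ 2 / 2) := by
    have h1 : (fun z => E z + z * deriv E z) = fun z => -(c * Complex.exp (c * z)) := by
      funext z
      have h := ((hasDerivAt_id z).mul (hEd z).hasDerivAt)
      have h2 : (id * E) = fun z => 1 - Complex.exp (c * z) := by
        funext w; simp [hE_mul]
      rw [h2] at h
      simpa using h.unique (hexp z)
    have hEdd : DifferentiableAt ℂ (deriv E) 0 := hEd.deriv 0
    have h2 : HasDerivAt (fun z => E z + z * deriv E z)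
        (deriv E 0 + (1 * deriv E 0 + 0 * deriv (deriv E) 0)) 0 :=
      (hEd 0).hasDerivAt.add ((hasDerivAt_id (0 : ℂ)).mul hEdd.hasDerivAt)
    have h3 : HasDerivAt (fun z => -(c * Complex.exp (c * z))) (-(c ^ 2)) 0 := by
      have := ((((hasDerivAt_id (0 : ℂ)).const_mul c).cexp).const_mul c).neg
      refine this.congr_deriv ?_
      simp
      ring
    rw [h1] at h2
    have := h2.unique h3
    linear_combination this / 2
  have hEne : ∀ z ∈ kernelStrip c, E z ≠ 0 := by
    intro z hz h
    rcases eq_or_ne z 0 with rfl | hz0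
    · rw [hE0] at h
      exact hc0 (neg_eq_zero.1 h)
    · apply exp_mul_ne_one hc hz hz0
      have := hE_mul z
      rw [h, mul_zero] at this
      exact (sub_eq_zero.1 this).symm
  set k : ℂ → ℂ := fun z => Complex.exp (β * z) / E z ^ 2 with hk
  have hkd : DifferentiableOn ℂ k (kernelStrip c) := fun z hz =>
    (DifferentiableAt.div (by fun_prop) ((hEd z).pow 2)
      (pow_ne_zero 2 (hEne z hz))).differentiableWithinAt
  have hk0 : k 0 = 1 / c ^ 2 := by simp [hk, hE0]
  have hk' : deriv k 0 = (β - c) / c ^ 2 := by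
    have h1 : HasDerivAt (fun z => Complex.exp (β * z)) β 0 := by
      simpa using ((hasDerivAt_id (0 : ℂ)).const_mul β).cexp
    have h2 := (hEd 0).hasDerivAt.pow 2
    have h3 := h1.div h2 (pow_ne_zero 2 (hEne 0 (zero_mem_kernelStrip hc)))
    have h4 : k = (fun z => Complex.exp (β * z)) / E ^ 2 := rfl
    rw [h4, h3.deriv]
    simp only [Pi.pow_apply, hE0, hE']
    simp
    field_simp
  have hqd : DifferentiableOn ℂ (dslope (dslope k 0) 0) (kernelStrip c) :=
    (Complex.differentiableOn_dslope hS).2 ((Complex.differentiableOn_dslope hS).2 hkd)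
  obtain ⟨P, hP⟩ := (convex_kernelStrip c).exists_forall_hasDerivWithinAt hqd
  refine ⟨P, dslope (dslope k 0) 0,
    fun z hz => (hP z hz).hasDerivAt ((isOpen_kernelStrip c).mem_nhds hz), hqd.continuousOn, ?_⟩
  intro z hz hz0
  have h1 := sub_smul_dslope k 0 z
  have h2 := sub_smul_dslope (dslope k 0) 0 z
  simp only [sub_zero, smul_eq_mul, dslope_same, hk', hk0] at h1 h2
  have h3 : expKernel c β z = k z / z ^ 2 := by
    have := hEne z hz
    simp only [expKernel, hk, hE_mul]
    field_simp
  have h4 : k z = 1 / c ^ 2 + z * ((β - c) / c ^ 2 + z * dslope (dslope k 0) 0 z) := by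
    linear_combination -h1 - z * h2
  rw [h3, h4]
  field_simp
  ring

/-! ### Behaviour at infinity in the strip -/

/-- The filter of points which tend to `+∞` in the strip. -/
def stripAtTop (c : ℂ) : Filter ℂ := comap Complex.re atTop ⊓ 𝓟 (kernelStrip c)

/-- The filter of points which tend to `-∞` in the strip. -/
def stripAtBot (c : ℂ) : Filter ℂ := comap Complex.re atBot ⊓ 𝓟 (kernelStrip c)

/-- The norm is `e^{Re b Re z - Im b Im z}`, and the second term of the exponent stays bounded in a
strip. -/
theorem tendsto_cexp_mul_zero {η : ℝ} {l : Filter ℂ} {b : ℂ} (him : ∀ᶠ z in l, |z.im| < η)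
    (hre : Tendsto (fun z : ℂ => b.re * z.re) l atBot) :
    Tendsto (fun z => Complex.exp (b * z)) l (𝓝 0) := by
  rw [tendsto_zero_iff_norm_tendsto_zero]
  simp only [Complex.norm_exp]
  refine Real.tendsto_exp_atBot.comp
    (tendsto_atBot_mono' l ?_ (tendsto_atBot_add_const_right l (|b.im| * η) hre))
  filter_upwards [him] with z hz
  rw [Complex.mul_re]
  have : -(b.im * z.im) ≤ |b.im| * η := by
    refine (neg_le_abs _).trans ?_
    rw [abs_mul]
    gcongr
  linarith

theorem tendsto_expKernel_stripAtBot {c β : ℂ} (hc : 0 < c.re) (hβ : 0 < β.re) :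
    Tendsto (expKernel c β) (stripAtBot c) (𝓝 0) := by
  have him : ∀ᶠ z in stripAtBot c, |z.im| < (expPeriod c).im :=
    mem_inf_of_right (mem_principal_self _)
  have hre : Tendsto Complex.re (stripAtBot c) atBot := tendsto_comap.mono_left inf_le_left
  have h1 := tendsto_cexp_mul_zero him (hre.const_mul_atBot hc)
  have h2 := tendsto_cexp_mul_zero him (hre.const_mul_atBot hβ)
  have := h2.div ((tendsto_const_nhds (x := (1 : ℂ))).sub h1 |>.pow 2) (by simp)
  rw [zero_div] at this
  exact this

/-- The quotient of the kernel by the exponential is `(1 - e^{-cz})⁻²`, which tends to `1`. The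
exponential itself is only bounded, as `Re (β - 2c) = 0`, so it has to be subtracted. -/
theorem tendsto_expKernel_sub_stripAtTop {c β : ℂ} (hc : 0 < c.re) (hβ : β.re = 2 * c.re) :
    Tendsto (fun z => expKernel c β z - Complex.exp ((β - 2 * c) * z)) (stripAtTop c) (𝓝 0) := by
  have him : ∀ᶠ z in stripAtTop c, |z.im| < (expPeriod c).im :=
    mem_inf_of_right (mem_principal_self _)
  have hre : Tendsto Complex.re (stripAtTop c) atTop := tendsto_comap.mono_left inf_le_left
  have h1 : Tendsto (fun z => Complex.exp (-c * z)) (stripAtTop c) (𝓝 0) :=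
    tendsto_cexp_mul_zero him (hre.const_mul_atTop_of_neg (by simpa using hc))
  have h2 : Tendsto (fun z => 1 / (1 - Complex.exp (-c * z)) ^ 2 - 1) (stripAtTop c) (𝓝 0) := by
    have := ((tendsto_const_nhds (x := (1 : ℂ))).div
      ((tendsto_const_nhds (x := (1 : ℂ))).sub h1 |>.pow 2) (by simp)).sub
        (tendsto_const_nhds (x := (1 : ℂ)))
    simpa using this
  have h3 : IsBoundedUnder (· ≤ ·) (stripAtTop c)
      (norm ∘ fun z => Complex.exp ((β - 2 * c) * z)) := by
    refine ⟨Real.exp (|(β - 2 * c).im| * (expPeriod c).im), ?_⟩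
    rw [eventually_map]
    filter_upwards [him] with z hz
    have h0 : (β - 2 * c).re = 0 := by simp [hβ]
    rw [Function.comp_apply, Complex.norm_exp, Complex.mul_re, h0, zero_mul, zero_sub]
    refine Real.exp_le_exp.2 ((neg_le_abs _).trans ?_)
    rw [abs_mul]
    gcongr
  refine (h2.zero_mul_isBoundedUnder_le h3).congr fun z => ?_
  have e1 : Complex.exp ((β - 2 * c) * z) = Complex.exp (β * z) * Complex.exp (-c * z) ^ 2 := by
    rw [← Complex.exp_nat_mul, ← Complex.exp_add]
    congr 1
    push_cast
    ring
  have e2 : Complex.exp (c * z) * Complex.exp (-c * z) = 1 := by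
    rw [← Complex.exp_add]; simp
  have e3 : (1 - Complex.exp (c * z)) ^ 2 * Complex.exp (-c * z) ^ 2
      = (1 - Complex.exp (-c * z)) ^ 2 := by
    rw [← mul_pow, sub_mul, e2]
    ring
  rw [sub_mul, one_mul, sub_left_inj, e1, ← e3, expKernel]
  have := Complex.exp_ne_zero (-c * z)
  field_simp

/-- Convexity is what the mean value inequality at infinity requires. -/
theorem hasBasis_stripAtTop_convex (c : ℂ) :
    ∀ t ∈ stripAtTop c, ∃ u ∈ stripAtTop c, u ⊆ t ∧ Convex ℝ u := by
  intro t ht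
  obtain ⟨R, -, hR⟩ := ((atTop_basis.comap Complex.re).inf_principal _).mem_iff.1 ht
  exact ⟨_, ((atTop_basis.comap Complex.re).inf_principal _).mem_of_mem trivial, hR,
    ((convex_Ici R).linear_preimage Complex.reLm).inter (convex_kernelStrip c)⟩

theorem hasBasis_stripAtBot_convex (c : ℂ) :
    ∀ t ∈ stripAtBot c, ∃ u ∈ stripAtBot c, u ⊆ t ∧ Convex ℝ u := by
  intro t ht
  obtain ⟨R, -, hR⟩ := ((atBot_basis.comap Complex.re).inf_principal _).mem_iff.1 ht
  exact ⟨_, ((atBot_basis.comap Complex.re).inf_principal _).mem_of_mem trivial, hR,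
    ((convex_Iic R).linear_preimage Complex.reLm).inter (convex_kernelStrip c)⟩

/-- Mean value inequality at infinity: a function whose derivative tends to `0` is asymptotically
unchanged by bounded shifts. -/
theorem tendsto_sub_zero_of_deriv_tendsto_zero {ι : Type*} {m : Filter ι} {l : Filter ℂ}
    {D D' : ℂ → ℂ} {f g : ι → ℂ} {C : ℝ} (hl : ∀ t ∈ l, ∃ u ∈ l, u ⊆ t ∧ Convex ℝ u)
    (hD : ∀ᶠ z in l, HasDerivAt D (D' z) z) (hD' : Tendsto D' l (𝓝 0))
    (hf : Tendsto f m l) (hg : Tendsto g m l) (hC : ∀ i, ‖f i - g i‖ ≤ C) :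
    Tendsto (fun i => D (f i) - D (g i)) m (𝓝 0) := by
  rcases isEmpty_or_nonempty ι with h | ⟨⟨i₀⟩⟩
  · simp [filter_eq_bot_of_isEmpty m]
  have hC0 : 0 ≤ C := (norm_nonneg _).trans (hC i₀)
  rw [Metric.tendsto_nhds]
  intro ε hε
  have hsmall : ∀ᶠ z in l, ‖D' z‖ < ε / (C + 1) := by
    have := Metric.tendsto_nhds.1 hD' (ε / (C + 1)) (by positivity)
    simpa using this
  obtain ⟨u, hul, hut, hu⟩ := hl _ (hD.and hsmall)
  filter_upwards [hf hul, hg hul] with i hfi hgi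
  rw [dist_zero_right]
  have := hu.norm_image_sub_le_of_norm_hasDerivWithin_le
    (fun z hz => (hut hz).1.hasDerivWithinAt) (fun z hz => (hut hz).2.le) hgi hfi
  calc ‖D (f i) - D (g i)‖ ≤ ε / (C + 1) * ‖f i - g i‖ := this
    _ ≤ ε / (C + 1) * C := by gcongr; exact hC i
    _ < ε / (C + 1) * (C + 1) := by gcongr; linarith
    _ = ε := by field_simp

theorem tendsto_ofReal_sub_stripAtTop {c z : ℂ} (hz : z ∈ kernelStrip c) :
    Tendsto (fun R : ℝ => (R : ℂ) - z) atTop (stripAtTop c) := by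
  refine tendsto_inf.2 ⟨tendsto_comap_iff.2 ?_, tendsto_principal.2 <| .of_forall
    fun R => ofReal_sub_mem_kernelStrip hz R⟩
  have : Complex.re ∘ (fun R : ℝ => (R : ℂ) - z) = fun R => R + -z.re := by
    funext R; simp [sub_eq_add_neg]
  rw [this]
  exact tendsto_atTop_add_const_right _ _ tendsto_id

theorem tendsto_ofReal_sub_stripAtBot {c z : ℂ} (hz : z ∈ kernelStrip c) :
    Tendsto (fun r : ℝ => (r : ℂ) - z) atBot (stripAtBot c) := by
  refine tendsto_inf.2 ⟨tendsto_comap_iff.2 ?_, tendsto_principal.2 <| .of_forall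
    fun R => ofReal_sub_mem_kernelStrip hz R⟩
  have : Complex.re ∘ (fun R : ℝ => (R : ℂ) - z) = fun R => R + -z.re := by
    funext R; simp [sub_eq_add_neg]
  rw [this]
  exact tendsto_atBot_add_const_right _ _ tendsto_id

/-! ### Finite part integrals of the kernel -/

/-- This jump between the two branches of the logarithm is the source of the half residue. -/
theorem log_neg_of_im_pos {z : ℂ} (hz : 0 < z.im) :
    Complex.log (-z) = Complex.log z - Real.pi * Complex.I := by
  simp only [Complex.log, norm_neg, Complex.arg_neg_eq_arg_sub_pi_of_im_pos hz]
  push_cast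
  ring

/-- The sides of the pole give opposite half residues: the integral of the kernel over a line off
the pole, compared with the finite part over the real line. -/
theorem exists_expKernel_comparison {c β : ℂ} (hc : 0 < c.re) (hβ : β.re = 2 * c.re)
    (hne : β ≠ 2 * c) :
    ∃ N : ℝ × ℝ → ℂ,
      (∀ r R : ℝ, r < 0 → 0 < R → HasFinitePart (fun σ : ℝ => expKernel c β σ) 0 r R
        (N (r, R) + Complex.exp ((β - 2 * c) * R) / (β - 2 * c))) ∧
      ∀ z ∈ kernelStrip c, z.im ≠ 0 → Tendsto (fun p : ℝ × ℝ =>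
        (∫ σ in p.1..p.2, expKernel c β (σ - z))
          - Complex.exp ((β - 2 * c) * (p.2 - z)) / (β - 2 * c) - N p) (atBot ×ˢ atTop)
        (𝓝 (SignType.sign z.im * (Real.pi * Complex.I * ((β - c) / c ^ 2)))) := by
  have hγ : β - 2 * c ≠ 0 := sub_ne_zero.2 hne
  obtain ⟨P, q, hP, hq, hlau⟩ := exists_laurent_expKernel hc β
  set c₂ : ℂ := 1 / c ^ 2
  set c₁ : ℂ := (β - c) / c ^ 2
  set γ : ℂ := β - 2 * c
  -- Two primitives for the two ends: `D₁` with the tail removed and the logarithm regular on the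
  -- right, `D₂` with `log (-z)` regular on the left. On the real axis both logarithms equal `log
  -- |t|`, so `D₁ R - D₂ r` is the finite part without its tail.
  set D₁ : ℂ → ℂ := fun z => P z - c₂ / z + c₁ * Complex.log z - Complex.exp (γ * z) / γ with hD₁
  set D₂ : ℂ → ℂ := fun z => P z - c₂ / z + c₁ * Complex.log (-z) with hD₂
  have hder : ∀ z ∈ kernelStrip c, z ∈ Complex.slitPlane → HasDerivAt
      (fun z => P z - c₂ / z + c₁ * Complex.log z) (expKernel c β z) z := by
    intro z hz hs
    have hz0 : z ≠ 0 := Complex.slitPlane_ne_zero hs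
    have h1 := (hasDerivAt_inv hz0).const_mul c₂
    have h2 := (Complex.hasDerivAt_log hs).const_mul c₁
    refine (((hP z hz).sub h1).add h2).congr_deriv ?_
    rw [hlau z hz hz0]
    field_simp
    ring
  have hder₁ : ∀ᶠ z in stripAtTop c,
      HasDerivAt D₁ (expKernel c β z - Complex.exp (γ * z)) z := by
    have hre : ∀ᶠ z in stripAtTop c, 0 < z.re :=
      (tendsto_comap.mono_left inf_le_left).eventually (eventually_gt_atTop 0)
    have hS : ∀ᶠ z in stripAtTop c, z ∈ kernelStrip c := mem_inf_of_right (mem_principal_self _)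
    filter_upwards [hre, hS] with z hz hzS
    have h1 := ((((hasDerivAt_id z).const_mul γ).cexp).div_const γ)
    refine ((hder z hzS (Or.inl hz)).sub h1).congr_deriv ?_
    simp only [id]
    field_simp
  have hder₂ : ∀ᶠ z in stripAtBot c, HasDerivAt D₂ (expKernel c β z) z := by
    have hre : ∀ᶠ z in stripAtBot c, z.re < 0 :=
      (tendsto_comap.mono_left inf_le_left).eventually (eventually_lt_atBot 0)
    have hS : ∀ᶠ z in stripAtBot c, z ∈ kernelStrip c := mem_inf_of_right (mem_principal_self _)
    filter_upwards [hre, hS] with z hz hzS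
    have hz0 : z ≠ 0 := by rintro rfl; simp at hz
    have h1 := (hasDerivAt_inv hz0).const_mul c₂
    have h2 : HasDerivAt (fun w : ℂ => c₁ * Complex.log (-w)) _ z :=
      ((hasDerivAt_neg z).clog (Or.inl (by simpa using hz))).const_mul c₁
    refine (((hP z hzS).sub h1).add h2).congr_deriv ?_
    rw [hlau z hzS hz0]
    field_simp
    ring
  refine ⟨fun p => D₁ p.2 - D₂ p.1, fun r R hr hR => ?_, fun z hz hzim => ?_⟩
  · have hPr : ∀ t : ℝ, HasDerivAt (fun s : ℝ => P s) (q t) t :=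
      fun t => (hP t (ofReal_mem_kernelStrip hc t)).comp_ofReal
    have hqr : Continuous fun t : ℝ => q t :=
      hq.comp_continuous Complex.continuous_ofReal (ofReal_mem_kernelStrip hc)
    have := hasFinitePart_of_laurent (F := fun σ : ℝ => expKernel c β σ) hPr hqr
      (fun t ht => hlau t (ofReal_mem_kernelStrip hc t) (by exact_mod_cast ht)) hr hR
    convert this using 1
    have h1 : Complex.log R = Real.log R := (Complex.ofReal_log hR.le).symm
    have h2 : Complex.log (-r) = Real.log r := by
      rw [← Real.log_neg_eq_log, Complex.ofReal_log (neg_nonneg.2 hr.le)]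
      simp
    simp only [hD₁, hD₂, h1, h2]
    ring
  -- The derivatives of `D₁` and `D₂` vanish at their ends, so moving both endpoints by `-z` has no
  -- effect in the limit.
  · have hT : Tendsto (fun p : ℝ × ℝ => (D₁ (p.2 - z) - D₁ p.2) - (D₂ (p.1 - z) - D₂ p.1))
        (atBot ×ˢ atTop) (𝓝 0) := by
      have hzero := zero_mem_kernelStrip hc
      have t1 := tendsto_sub_zero_of_deriv_tendsto_zero (C := ‖z‖) (hasBasis_stripAtTop_convex c)
        hder₁ (tendsto_expKernel_sub_stripAtTop hc hβ) (tendsto_ofReal_sub_stripAtTop hz)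
        (tendsto_ofReal_sub_stripAtTop hzero) (fun R => by simp)
      have t2 := tendsto_sub_zero_of_deriv_tendsto_zero (C := ‖z‖) (hasBasis_stripAtBot_convex c)
        hder₂ (tendsto_expKernel_stripAtBot hc (by rw [hβ]; positivity))
        (tendsto_ofReal_sub_stripAtBot hz)
        (tendsto_ofReal_sub_stripAtBot hzero) (fun R => by simp)
      simp only [sub_zero] at t1 t2
      simpa using (t1.comp tendsto_snd).sub (t2.comp tendsto_fst)
    have hint : ∀ p : ℝ × ℝ, (∫ σ in p.1..p.2, expKernel c β (σ - z))
        = (P (p.2 - z) - c₂ / (p.2 - z) + c₁ * Complex.log (p.2 - z))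
          - (P (p.1 - z) - c₂ / (p.1 - z) + c₁ * Complex.log (p.1 - z)) := by
      intro p
      have hmem : ∀ t : ℝ, (t : ℂ) - z ∈ kernelStrip c := ofReal_sub_mem_kernelStrip hz
      have hsl : ∀ t : ℝ, (t : ℂ) - z ∈ Complex.slitPlane := fun t => Or.inr (by simpa using hzim)
      have hd : ∀ t : ℝ, HasDerivAt (fun s : ℝ => P (s - z) - c₂ / (s - z)
          + c₁ * Complex.log (s - z)) (expKernel c β (t - z)) t := fun t =>
        ((hder _ (hmem t) (hsl t)).comp_sub_const (t : ℂ) z).comp_ofReal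
      refine intervalIntegral.integral_eq_sub_of_hasDerivAt (fun t _ => hd t)
        (Continuous.intervalIntegrable ?_ _ _)
      unfold expKernel
      refine Continuous.div (by fun_prop) (by fun_prop) fun t => pow_ne_zero 2 (sub_ne_zero.2 ?_)
      exact (exp_mul_ne_one hc (hmem t) (Complex.slitPlane_ne_zero (hsl t))).symm
    -- Off the real axis the principal logarithm serves along the whole line; it disagrees with the
    -- branch in `D₂` at the left end only.
    have hlog : ∀ r : ℝ, Complex.log (-(r - z)) - Complex.log (r - z)
        = SignType.sign z.im * (Real.pi * Complex.I) := by
      intro r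
      rcases hzim.lt_or_gt with h | h
      · rw [log_neg_of_im_pos (by simpa using h), sign_neg h]
        simp
      · have := log_neg_of_im_pos (z := -(r - z)) (by simpa using h)
        rw [neg_neg] at this
        rw [this, sign_pos h]
        simp
    refine ((hT.add_const _).congr fun p => ?_).trans (by rw [zero_add])
    rw [hint]
    simp only [hD₁, hD₂]
    linear_combination (-c₁) * hlog p.1

/-- The integral of the kernel along the real line shifted by `-z`, where the exponential tail at
`+∞` is subtracted, converges to a value which depends only on the sign of `Im z`. -/
theorem exists_expKernel_finitePart {c β : ℂ} (hc : 0 < c.re) (hβ : β.re = 2 * c.re)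
    (hne : β ≠ 2 * c) {B : ℂ} (hB : B = -Complex.I * β / c) {z : ℂ} (hz : z ∈ kernelStrip c)
    (hz0 : z.im = 0 → z = 0) :
    ∃ I : ℝ → ℝ → ℂ, (∀ r R : ℝ, r < 0 → 0 < R →
        HasFinitePart (fun σ : ℝ => expKernel c β (σ - z)) 0 r R (I r R)) ∧
      Tendsto (fun p : ℝ × ℝ =>
        I p.1 p.2 - Complex.exp ((β - 2 * c) * (p.2 - z)) / (β - 2 * c)) (atBot ×ˢ atTop)
        (𝓝 (Real.pi * Complex.I * ((β - c) / c ^ 2) *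
          ((if z.im < 0 then Complex.exp (-Real.pi * B)
            else if z.im = 0 then Complex.cosh (Real.pi * B)
            else Complex.exp (Real.pi * B)) / Complex.sinh (Real.pi * B)))) := by
  obtain ⟨N, hN, hcomp⟩ := exists_expKernel_comparison hc hβ hne
  have hc0 : c ≠ 0 := by rintro rfl; simp at hc
  set γ : ℂ := β - 2 * c with hγdef
  have hγ : γ ≠ 0 := sub_ne_zero.2 hne
  set K : ℂ := Real.pi * Complex.I * ((β - c) / c ^ 2)
  set p := expPeriod c with hp
  have hpos : 0 < p.im := expPeriod_im_pos hc
  have hmul : Complex.exp (β * p) = Complex.exp (-Real.pi * B) ^ 2 := by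
    rw [← Complex.exp_nat_mul, hB, hp, expPeriod]
    congr 1
    push_cast
    field_simp
  have hγp : Complex.exp (γ * p) = Complex.exp (β * p) := by
    have : γ * p = β * p - ((2 : ℤ) : ℂ) * (2 * Real.pi * Complex.I) := by
      rw [hγdef, hp, expPeriod]
      field_simp
      push_cast
      ring
    rw [this, Complex.exp_sub, Complex.exp_int_mul_two_pi_mul_I, div_one]
  have hinv : Complex.exp (-Real.pi * B) * Complex.exp (Real.pi * B) = 1 := by
    rw [← Complex.exp_add]; simp
  -- Equality would make `γ` an integer multiple of `c`; since `Re γ = 0 < Re c`, this forces `γ =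
  -- 0`.
  have hexp1 : Complex.exp (β * p) ≠ 1 := by
    rw [← hγp]
    intro h
    obtain ⟨n, hn⟩ := Complex.exp_eq_one_iff.1 h
    have h1 : γ = n * c := by
      have := Complex.two_pi_I_ne_zero
      rw [hp, expPeriod] at hn
      field_simp at hn
      rw [hn, mul_comm]
    have h2 : γ.re = 0 := by simp [hγdef, hβ]
    have h3 : γ.re = n * c.re := by
      rw [h1]
      simp
    have h4 : (n : ℝ) = 0 := by
      rw [h2] at h3
      exact (mul_eq_zero.1 h3.symm).resolve_right hc.ne'
    apply hγ
    rw [h1]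
    have : n = 0 := by exact_mod_cast h4
    simp [this]
  have hsinh : Complex.sinh (Real.pi * B) ≠ 0 := by
    intro h
    apply hexp1
    rw [Complex.sinh, ← neg_mul] at h
    rw [hmul, sq]
    nth_rewrite 2 [← sub_eq_zero.1 ((div_eq_zero_iff.1 h).resolve_right two_ne_zero)]
    exact hinv
  -- compare the lines through `p / 2` and `-p / 2`
  have hNlim : Tendsto N (atBot ×ˢ atTop)
      (𝓝 (K * (Complex.cosh (Real.pi * B) / Complex.sinh (Real.pi * B)))) := by
    have him : (p / 2).im = p.im / 2 := by simp
    have him' : (-(p / 2)).im = -(p.im / 2) := by simp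
    have h1 := hcomp (p / 2) (by
      change |(p / 2).im| < p.im
      rw [him, abs_of_pos (by positivity)]; linarith) (by rw [him]; positivity)
    have h2 := hcomp (-(p / 2)) (by
      change |(-(p / 2)).im| < p.im
      rw [him', abs_neg, abs_of_pos (by positivity)]; linarith)
      (by rw [him', neg_ne_zero]; positivity)
    rw [him, sign_pos (by positivity)] at h1
    rw [him', sign_neg (by simpa using hpos)] at h2
    -- The line for `-p/2` carries `e^{βp}` times the integral and the tail of the line for `p/2`.
    -- Eliminating these leaves `(1 - e^{βp}) N`, up to sign, in terms of the half residues.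
    have h3 := ((h2.sub (h1.const_mul (Complex.exp (β * p)))).neg).div_const
      (1 - Complex.exp (β * p))
    have hne1 : 1 - Complex.exp (β * p) ≠ 0 := sub_ne_zero.2 hexp1.symm
    refine (h3.congr fun x => ?_).trans (le_of_eq ?_)
    · have e1 : (∫ σ in x.1..x.2, expKernel c β (σ - -(p / 2)))
          = Complex.exp (β * p) * ∫ σ in x.1..x.2, expKernel c β (σ - p / 2) := by
        rw [← intervalIntegral.integral_const_mul]
        refine intervalIntegral.integral_congr fun σ _ => ?_
        rw [← expKernel_add_period hc]
        congr 1
        rw [← hp]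
        ring
      have e2 : Complex.exp (γ * (x.2 - -(p / 2)))
          = Complex.exp (β * p) * Complex.exp (γ * (x.2 - p / 2)) := by
        rw [← hγp, ← Complex.exp_add]
        congr 1
        ring
      rw [e1, e2, div_eq_iff hne1]
      ring
    · congr 1
      have hch : Complex.cosh (Real.pi * B)
          = (Complex.exp (Real.pi * B) + Complex.exp (-Real.pi * B)) / 2 := by
        rw [Complex.cosh, neg_mul]
      have hsh : Complex.sinh (Real.pi * B)
          = (Complex.exp (Real.pi * B) - Complex.exp (-Real.pi * B)) / 2 := by
        rw [Complex.sinh, neg_mul]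
      rw [hsh] at hsinh
      rw [div_eq_iff hne1, hmul, hch, hsh]
      generalize Complex.exp (Real.pi * B) = u at *
      generalize Complex.exp (-Real.pi * B) = v at *
      have hs : u - v ≠ 0 := by
        intro h; simp [h] at hsinh
      clear_value K
      simp only [SignType.coe_neg, SignType.coe_one]
      field_simp
      linear_combination (2 * K * v) * hinv
  have hadd : Complex.cosh (Real.pi * B) + Complex.sinh (Real.pi * B)
      = Complex.exp (Real.pi * B) := Complex.cosh_add_sinh _
  have hsub : Complex.cosh (Real.pi * B) - Complex.sinh (Real.pi * B)
      = Complex.exp (-Real.pi * B) := by rw [neg_mul]; exact Complex.cosh_sub_sinh _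
  rcases eq_or_ne z.im 0 with him | him
  · obtain rfl := hz0 him
    refine ⟨fun r R => N (r, R) + Complex.exp (γ * R) / γ, fun r R hr hR => by
      simpa using hN r R hr hR, ?_⟩
    simpa using hNlim
  · refine ⟨fun r R => ∫ σ in r..R, expKernel c β (σ - z), fun r R hr hR => ?_, ?_⟩
    · refine hasFinitePart_of_continuous ?_ hr hR
      unfold expKernel
      refine Continuous.div (by fun_prop) (by fun_prop) fun t => pow_ne_zero 2 (sub_ne_zero.2 ?_)
      refine (exp_mul_ne_one hc (ofReal_sub_mem_kernelStrip hz t) fun h => him ?_).symm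
      simpa using congrArg Complex.im h
    · refine (((hcomp z hz him).add hNlim).congr fun x => by ring).trans (le_of_eq ?_)
      congr 1
      rcases him.lt_or_gt with h | h
      · rw [if_pos h, sign_neg h, ← hsub]
        simp only [SignType.coe_neg, SignType.coe_one]
        field_simp
        ring
      · rw [if_neg h.not_gt, if_neg h.ne', sign_pos h, ← hadd]
        simp only [SignType.coe_one]
        field_simp
        ring

/-- The weight `e^{ΔB} · (e^{-πB}, cosh πB, e^{πB})` as `Δ` is positive, zero or negative. -/
def sidedWeight (Δ : ℝ) (B : ℂ) : ℂ :=
  Complex.exp (Δ * B) *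
    if 0 < Δ then Complex.exp (-Real.pi * B)
    else if Δ = 0 then Complex.cosh (Real.pi * B)
    else Complex.exp (Real.pi * B)

/-- The finite part integral over a real interval of the kernel with a pole at angle `Δ`. -/
theorem exists_rotatedKernel_finitePart {c β : ℂ} (hc : 0 < c.re) (hβ : β.re = 2 * c.re)
    (hne : β ≠ 2 * c) {B : ℂ} (hB : B = -Complex.I * β / c) {Δ : ℝ} (hΔ : |Δ| < 2 * Real.pi) :
    ∃ I : ℝ → ℝ → ℂ, (∀ r R : ℝ, r < 0 → 0 < R → HasFinitePart (fun σ : ℝ =>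
        Complex.exp (β * σ) / (1 - Complex.exp (c * σ) * Complex.exp (Complex.I * Δ)) ^ 2)
          0 r R (I r R)) ∧
      Tendsto (fun p : ℝ × ℝ => I p.1 p.2
          - Complex.exp (-2 * Complex.I * Δ) * (Complex.exp ((β - 2 * c) * p.2) / (β - 2 * c)))
        (atBot ×ˢ atTop) (𝓝 (Real.pi * Complex.I * ((β - c) / c ^ 2) *
          (sidedWeight Δ B / Complex.sinh (Real.pi * B)))) := by
  have hc0 : c ≠ 0 := by rintro rfl; simp at hc
  have hn := Complex.normSq_pos.2 hc0
  set z : ℂ := -Complex.I * Δ / c with hz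
  have hzim : z.im = -(Δ * (c.re / Complex.normSq c)) := by
    simp [hz, Complex.div_im]
    ring
  have hρ : 0 < c.re / Complex.normSq c := by positivity
  have hzS : z ∈ kernelStrip c := by
    change |z.im| < (expPeriod c).im
    rw [hzim, abs_neg, abs_mul, abs_of_pos hρ, expPeriod_im, mul_div_assoc]
    gcongr
  have hz0 : z.im = 0 → z = 0 := by
    intro h
    rw [hzim, neg_eq_zero] at h
    simp [hz, (mul_eq_zero.1 h).resolve_right hρ.ne']
  obtain ⟨I, hI, hlim⟩ := exists_expKernel_finitePart hc hβ hne hB hzS hz0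
  refine ⟨fun r R => Complex.exp (Δ * B) * I r R, fun r R hr hR => ?_, ?_⟩
  · convert (hI r R hr hR).const_mul (Complex.exp (Δ * B)) using 2 with σ
    rw [expKernel, ← mul_div_assoc, ← Complex.exp_add, ← Complex.exp_add]
    congr 2
    · rw [hz, hB]; field_simp; ring
    · rw [hz]; congr 2; field_simp; ring
  · refine ((hlim.const_mul (Complex.exp (Δ * B))).congr fun x => ?_).trans (le_of_eq ?_)
    -- Since `ΔB = βz`, the exponents combine to `2cz = -2iΔ`, free of `β`.
    · have : Complex.exp (Δ * B) * Complex.exp ((β - 2 * c) * (x.2 - z))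
          = Complex.exp (-2 * Complex.I * Δ) * Complex.exp ((β - 2 * c) * x.2) := by
        rw [← Complex.exp_add, ← Complex.exp_add, hz, hB]
        congr 1
        field_simp
        ring
      rw [mul_sub, ← mul_div_assoc, this, mul_div_assoc]
    · have h1 : z.im < 0 ↔ 0 < Δ := by
        rw [hzim, neg_lt_zero, mul_pos_iff_of_pos_right hρ]
      have h2 : z.im = 0 ↔ Δ = 0 := by
        rw [hzim, neg_eq_zero, mul_eq_zero, or_iff_left hρ.ne']
      simp only [h1, h2, sidedWeight]
      congr 1
      ring

/-! ### Sums over the branches of the spiral -/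

theorem HasFinitePartLine.add {F G : ℝ → ℂ} {x : ℝ} {L K : ℂ} (hF : HasFinitePartLine F x L)
    (hG : HasFinitePartLine G x K) : HasFinitePartLine (fun t => F t + G t) x (L + K) := by
  obtain ⟨I, hI, hL⟩ := hF
  obtain ⟨J, hJ, hK⟩ := hG
  exact ⟨fun a b => I a b + J a b, fun a b ha hb => (hI a b ha hb).add ha hb (hJ a b ha hb),
    hL.add hK⟩

theorem HasFinitePartLine.congr {F G : ℝ → ℂ} {x : ℝ} {L : ℂ} (hF : HasFinitePartLine F x L)
    (h : ∀ t, G t = F t) : HasFinitePartLine G x L :=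
  funext h ▸ hF

theorem HasFinitePartLine.const_mul {F : ℝ → ℂ} {x : ℝ} {L : ℂ} (w : ℂ)
    (hF : HasFinitePartLine F x L) : HasFinitePartLine (fun t => w * F t) x (w * L) := by
  obtain ⟨I, hI, hL⟩ := hF
  exact ⟨fun a b => w * I a b, fun a b ha hb => (hI a b ha hb).const_mul w, hL.const_mul w⟩

/-- The improper finite part integral of a combination of kernels with poles at the angles `Δ k`
exists as soon as the leading terms at `+∞` cancel. -/
theorem hasFinitePartLine_sum_rotatedKernel {ι : Type*} [Fintype ι] {c β : ℂ} (hc : 0 < c.re)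
    (hβ : β.re = 2 * c.re) (hne : β ≠ 2 * c) {B : ℂ} (hB : B = -Complex.I * β / c) {Δ : ι → ℝ}
    (hΔ : ∀ k, |Δ k| < 2 * Real.pi) {x : ι → ℂ}
    (hx : ∑ k, x k * Complex.exp (-2 * Complex.I * Δ k) = 0) :
    HasFinitePartLine (fun σ : ℝ => ∑ k, x k * (Complex.exp (β * σ) /
        (1 - Complex.exp (c * σ) * Complex.exp (Complex.I * Δ k)) ^ 2)) 0
      (Real.pi * Complex.I * ((β - c) / c ^ 2) *
        ∑ k, x k * (sidedWeight (Δ k) B / Complex.sinh (Real.pi * B))) := by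
  choose I hI hlim using fun k => exists_rotatedKernel_finitePart hc hβ hne hB (hΔ k)
  refine ⟨fun r R => ∑ k, x k * I k r R, fun r R hr hR => HasFinitePart.sum _ hr hR
    fun k _ => (hI k r R hr hR).const_mul (x k), ?_⟩
  have h := tendsto_finsetSum Finset.univ fun k _ => (hlim k).const_mul (x k)
  refine (h.congr fun p => ?_).trans (le_of_eq ?_)
  · simp only [mul_sub, Finset.sum_sub_distrib, ← mul_assoc]
    rw [← Finset.sum_mul]
    simp only [mul_assoc] at hx ⊢
    rw [hx, zero_mul, sub_zero]
  · rw [Finset.mul_sum]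
    congr 1
    exact Finset.sum_congr rfl fun k _ => by ring

/-- A shift by `i` flips the sign of each of `e^{±πB}`, `cosh πB` and `sinh πB`, which cancels in
the quotient and leaves only the factor from `e^{ΔB}`. -/
theorem sidedWeight_sub_I_div_sinh (Δ : ℝ) (B : ℂ) :
    sidedWeight Δ (B - Complex.I) / Complex.sinh (Real.pi * (B - Complex.I))
      = Complex.exp (-Complex.I * Δ) * (sidedWeight Δ B / Complex.sinh (Real.pi * B)) := by
  have e0 : Complex.exp (Real.pi * Complex.I) = -1 := Complex.exp_pi_mul_I
  have e1 : Complex.exp (Real.pi * (B - Complex.I)) = -Complex.exp (Real.pi * B) := by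
    rw [mul_sub, Complex.exp_sub, e0, div_neg, div_one]
  have e2 : Complex.exp (-Real.pi * (B - Complex.I)) = -Complex.exp (-Real.pi * B) := by
    rw [mul_sub, neg_mul _ Complex.I, sub_neg_eq_add, Complex.exp_add, e0, mul_neg_one]
  have e3 : Complex.cosh (Real.pi * (B - Complex.I)) = -Complex.cosh (Real.pi * B) := by
    rw [Complex.cosh, Complex.cosh, ← neg_mul, e1, e2, neg_mul]
    ring
  have e4 : Complex.sinh (Real.pi * (B - Complex.I)) = -Complex.sinh (Real.pi * B) := by
    rw [Complex.sinh, Complex.sinh, ← neg_mul, e1, e2, neg_mul]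
    ring
  have e5 : Complex.exp (Δ * (B - Complex.I))
      = Complex.exp (-Complex.I * Δ) * Complex.exp (Δ * B) := by
    rw [← Complex.exp_add]
    congr 1
    ring
  unfold sidedWeight
  rw [e1, e2, e3, e4, e5]
  split_ifs <;> ring

theorem abs_angleDiff_lt (M : ℕ) (k m : Fin M) : |angleDiff M k m| < 2 * Real.pi := by
  have hM : (0 : ℝ) < M := by exact_mod_cast m.pos
  have hk : (k : ℝ) < M := by exact_mod_cast k.2
  have hm : (m : ℝ) < M := by exact_mod_cast m.2
  have hk0 : (0 : ℝ) ≤ k := Nat.cast_nonneg _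
  have hm0 : (0 : ℝ) ≤ m := Nat.cast_nonneg _
  have h : angleDiff M k m = 2 * Real.pi * (((k : ℝ) - m) / M) := by
    unfold angleDiff angle
    ring
  rw [h, abs_mul, abs_of_pos Real.two_pi_pos]
  have : |((k : ℝ) - m) / M| < 1 := by
    rw [abs_div, abs_of_pos hM, div_lt_one hM, abs_lt]
    constructor <;> linarith
  nlinarith [Real.two_pi_pos]

theorem angleDiff_pos_iff {M : ℕ} (k m : Fin M) : 0 < angleDiff M k m ↔ (m : ℕ) < k := by
  have hM : (0 : ℝ) < M := by exact_mod_cast m.pos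
  have h : angleDiff M k m = 2 * Real.pi / M * ((k : ℝ) - m) := by
    unfold angleDiff angle
    ring
  rw [h, mul_pos_iff_of_pos_left (by positivity), sub_pos, Nat.cast_lt]

theorem angleDiff_eq_zero_iff {M : ℕ} (k m : Fin M) : angleDiff M k m = 0 ↔ (k : ℕ) = m := by
  have hM : (0 : ℝ) < M := by exact_mod_cast m.pos
  have h : angleDiff M k m = 2 * Real.pi / M * ((k : ℝ) - m) := by
    unfold angleDiff angle
    ring
  have h2 : 2 * Real.pi / M ≠ 0 := by positivity
  rw [h, mul_eq_zero, or_iff_right h2, sub_eq_zero, Nat.cast_inj]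

theorem exp_angleDiff {M : ℕ} (w : ℂ) (k m : Fin M) :
    Complex.exp (w * angleDiff M k m)
      = Complex.exp (2 * Real.pi * w / M) ^ (k : ℕ)
        * (Complex.exp (2 * Real.pi * w / M) ^ (m : ℕ))⁻¹ := by
  rw [← Complex.exp_nat_mul, ← Complex.exp_nat_mul, ← Complex.exp_neg, ← Complex.exp_add]
  congr 1
  unfold angleDiff angle
  push_cast
  ring

/-- The sum of the weights over equidistributed angles is a geometric sum. -/
theorem sum_sidedWeight_div_sinh {M : ℕ} (m : Fin M) {A : ℂ}
    (hA : Complex.exp (2 * Real.pi * A) ≠ 1) :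
    ∑ k, sidedWeight (angleDiff M k m) A / Complex.sinh (Real.pi * A)
      = Complex.cosh (Real.pi * A / M) / Complex.sinh (Real.pi * A / M) := by
  have hM : (M : ℂ) ≠ 0 := by exact_mod_cast m.pos.ne'
  set v := Complex.exp (Real.pi * A / M) with hv
  set q := Complex.exp (2 * Real.pi * A / M) with hq
  set E := Complex.exp (Real.pi * A) with hE
  have hv0 : v ≠ 0 := Complex.exp_ne_zero _
  have hq0 : q ≠ 0 := Complex.exp_ne_zero _
  have hE0 : E ≠ 0 := Complex.exp_ne_zero _
  have hqv : q = v ^ 2 := by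
    rw [hq, hv, ← Complex.exp_nat_mul]; congr 1; push_cast; ring
  have hqM : q ^ M = E ^ 2 := by
    rw [hq, hE, ← Complex.exp_nat_mul, ← Complex.exp_nat_mul]
    congr 1
    field_simp
    push_cast
    ring
  have hE1 : E ^ 2 ≠ 1 := by
    rw [hE, ← Complex.exp_nat_mul]
    have : ((2 : ℕ) : ℂ) * (Real.pi * A) = 2 * Real.pi * A := by push_cast; ring
    rwa [this]
  have hq1 : q ≠ 1 := by
    intro h
    rw [h, one_pow] at hqM
    exact hE1 hqM.symm
  have hEinv : Complex.exp (-Real.pi * A) = E⁻¹ := by rw [hE, ← Complex.exp_neg, neg_mul]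
  have hcosh : Complex.cosh (Real.pi * A) = (E + E⁻¹) / 2 := by
    rw [Complex.cosh, ← neg_mul, hEinv]
  have hsinh : Complex.sinh (Real.pi * A) = (E - E⁻¹) / 2 := by
    rw [Complex.sinh, ← neg_mul, hEinv]
  have hterm : ∀ k : Fin M, sidedWeight (angleDiff M k m) A =
      (fun j : ℕ => q ^ j * (q ^ (m : ℕ))⁻¹ *
        if (m : ℕ) < j then E⁻¹ else if j = m then (E + E⁻¹) / 2 else E) k := by
    intro k
    simp only [sidedWeight, angleDiff_pos_iff, angleDiff_eq_zero_iff, hEinv, hcosh]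
    rw [mul_comm (angleDiff M k m : ℂ) A, exp_angleDiff]
  rw [← Finset.sum_div, Finset.sum_congr rfl fun k _ => hterm k,
    Fin.sum_univ_eq_sum_range (fun j : ℕ => q ^ j * (q ^ (m : ℕ))⁻¹ *
        if (m : ℕ) < j then E⁻¹ else if j = m then (E + E⁻¹) / 2 else E) M]
  -- The branches split into `m` below the index `m`, the branch itself, and `n` above it.
  obtain ⟨n, hn⟩ : ∃ n, M = m + 1 + n := Nat.exists_eq_add_of_le m.2
  generalize (m : ℕ) = m' at *
  have hsum : ∑ j ∈ Finset.range M, (q ^ j * (q ^ m')⁻¹ *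
        if m' < j then E⁻¹ else if j = m' then (E + E⁻¹) / 2 else E)
      = (∑ j ∈ Finset.range m', q ^ j) * (q ^ m')⁻¹ * E + (E + E⁻¹) / 2
        + (∑ j ∈ Finset.range n, q ^ j) * q * E⁻¹ := by
    rw [hn, Finset.sum_range_add, Finset.sum_range_succ, Finset.sum_mul, Finset.sum_mul,
      Finset.sum_mul, Finset.sum_mul]
    congr 1
    · congr 1
      · refine Finset.sum_congr rfl fun j hj => ?_
        have := Finset.mem_range.1 hj
        rw [if_neg (by omega), if_neg (by omega)]
      · rw [if_neg (by omega), if_pos rfl]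
        field_simp
    · refine Finset.sum_congr rfl fun j hj => ?_
      rw [if_pos (by omega), pow_add, pow_add]
      field_simp
  have hq1' : q - 1 ≠ 0 := sub_ne_zero.2 hq1
  have hqn : q ^ n * q ^ m' * q = E ^ 2 := by
    rw [← hqM, hn]; ring
  rw [hsum, geom_sum_eq hq1, geom_sum_eq hq1, hsinh, Complex.cosh, Complex.sinh, Complex.exp_neg,
    ← hv]
  have hE2 : E ^ 2 - 1 ≠ 0 := sub_ne_zero.2 hE1
  have hEE : E - E⁻¹ ≠ 0 := by
    intro h
    apply hE2
    field_simp at h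
    simpa using h
  have hvv : v - v⁻¹ ≠ 0 := by
    intro h
    apply hq1'
    field_simp at h
    rw [hqv]
    simpa using h
  have hqm : q ^ m' ≠ 0 := pow_ne_zero _ hq0
  have hvq : (v + v⁻¹) / 2 / ((v - v⁻¹) / 2) = (q + 1) / (q - 1) := by
    rw [div_div_div_cancel_right₀ two_ne_zero, div_eq_div_iff hvv hq1', hqv]
    field_simp
  have hnn : q ^ n = E ^ 2 * (q ^ m')⁻¹ * q⁻¹ := by
    rw [← hqn]; field_simp
  rw [hvq, hnn]
  generalize q ^ m' = r at *
  rw [div_eq_div_iff (div_ne_zero hEE two_ne_zero) hq1']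
  field_simp
  ring

/-- A sum of powers of an `M`-th root of unity, which differs from `1` because `M ≥ 3` does not
divide `2`. -/
theorem sum_exp_angleDiff_eq_zero {M : ℕ} (hM : 3 ≤ M) (m : Fin M) :
    ∑ k, Complex.exp (-2 * Complex.I * angleDiff M k m) = 0 := by
  have hM0 : (M : ℂ) ≠ 0 := by exact_mod_cast m.pos.ne'
  simp only [exp_angleDiff]
  rw [← Finset.sum_mul, Fin.sum_univ_eq_sum_range
    (fun j : ℕ => Complex.exp (2 * Real.pi * (-2 * Complex.I) / M) ^ j) M]
  have h1 : Complex.exp (2 * Real.pi * (-2 * Complex.I) / M) ≠ 1 := by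
    intro h
    obtain ⟨n, hn⟩ := Complex.exp_eq_one_iff.1 h
    have h2 : ((-2 : ℤ) : ℂ) = (n * M : ℤ) := by
      have := Complex.two_pi_I_ne_zero
      apply mul_right_cancel₀ this
      field_simp at hn
      push_cast
      linear_combination (2 * Real.pi * Complex.I) * hn
    have h3 : -2 = n * (M : ℤ) := by exact_mod_cast h2
    have h4 : (M : ℤ) ∣ 2 := ⟨-n, by linarith⟩
    have := Int.le_of_dvd (by norm_num) h4
    omega
  have h2 : Complex.exp (2 * Real.pi * (-2 * Complex.I) / M) ^ M = 1 := by
    rw [← Complex.exp_nat_mul, Complex.exp_eq_one_iff]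
    refine ⟨-2, ?_⟩
    field_simp
    push_cast
    ring
  rw [geom_sum_eq h1, h2]
  simp

/-! ### The operator on the ansatz -/

/-- The shift `Δ_{km}` compensates for the offset `θ_k` in `Γ_k`, so the branch index leaves the
exponential. -/
theorem mode_shift {a μ g α : ℝ} (hg : g ≠ 0) (s : ℝ) {M : ℕ} (k m : Fin M) {t : ℝ} (ht : 0 < t)
    (θ σ : ℝ) :
    mode s a μ g α M k t (σ + θ + angleDiff M k m)
      = mode s a μ g α M m t θ * Complex.exp (s * Complex.I * α * (2 * a * σ)) := by
  rw [mode_eq s a μ g α hg M k t _ ht, mode_eq s a μ g α hg M m t _ ht, ← Complex.exp_add]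
  congr 1
  unfold angleDiff
  push_cast
  ring

theorem ofReal_add_I_ne_zero (a : ℝ) : (a : ℂ) + Complex.I ≠ 0 := fun h => by
  simpa using congrArg Complex.im h

theorem hasFinitePartLine_self {M : ℕ} (hM : 3 ≤ M) {a : ℝ} (ha : 0 < a) (m : Fin M) :
    HasFinitePartLine (fun σ : ℝ => ∑ k : Fin M, Complex.exp (2 * a * σ) /
        (1 - Complex.exp ((a + Complex.I) * σ)
          * Complex.exp (Complex.I * angleDiff M k m)) ^ 2) 0
      (Real.pi * Complex.I * ((a - Complex.I) / (a + Complex.I) ^ 2) *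
        (Complex.cosh (Real.pi * coeffA a / M) / Complex.sinh (Real.pi * coeffA a / M))) := by
  have hc0 := ofReal_add_I_ne_zero a
  have hA : coeffA a = -Complex.I * (2 * a) / (a + Complex.I) := by
    unfold coeffA
    ring
  have hA1 : Complex.exp (2 * Real.pi * coeffA a) ≠ 1 := by
    intro h
    obtain ⟨n, hn⟩ := Complex.exp_eq_one_iff.1 h
    have h1 : -(2 * a : ℂ) = n * (a + Complex.I) := by
      apply mul_right_cancel₀ Complex.two_pi_I_ne_zero
      rw [hA] at hn
      field_simp at hn
      linear_combination (2 * Real.pi * Complex.I) * hn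
    have h2 := congrArg Complex.im h1
    have h3 := congrArg Complex.re h1
    simp at h2 h3
    simp [← h2] at h3
    exact ha.ne' h3
  have h := hasFinitePartLine_sum_rotatedKernel (c := a + Complex.I) (β := 2 * a)
    (by simpa using ha) (by simp) (fun h => by simpa using congrArg Complex.im h) hA
    (fun k => abs_angleDiff_lt M k m) (x := fun _ => 1)
    (by simpa using sum_exp_angleDiff_eq_zero hM m)
  simp only [one_mul, sum_sidedWeight_div_sinh m hA1] at h
  convert h using 3
  ring

theorem hasFinitePartLine_mode {M : ℕ} {a s α : ℝ} (ha : 0 < a) (hs : 2 * a * α * s ≠ 1)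
    (m : Fin M) {x : Fin M → ℂ} (hx : ∑ k, x k * Complex.exp (-Complex.I * angle M k) = 0) :
    HasFinitePartLine (fun σ : ℝ => ∑ k : Fin M,
        x k * Complex.exp (Complex.I * angleDiff M k m) *
        (Complex.exp ((2 * a + Complex.I + s * 2 * Complex.I * α * a) * σ) /
        (1 - Complex.exp ((a + Complex.I) * σ)
          * Complex.exp (Complex.I * angleDiff M k m)) ^ 2)) 0
      (Real.pi * Complex.I / a * ∑ k, cmk s a α M m k * x k) := by
  have hc0 := ofReal_add_I_ne_zero a
  have ha0 : (a : ℂ) ≠ 0 := by exact_mod_cast ha.ne'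
  have ha1 : (1 + (a : ℂ) ^ 2) ≠ 0 := by
    have : (0 : ℝ) < 1 + a ^ 2 := by positivity
    exact_mod_cast this.ne'
  -- The factor `e^{iσ}` of the ansatz moves the kernel's parameter from `B_±` to `B_± - i`; the
  -- resulting `e^{-iΔ}` in the weight cancels the `e^{iΔ}` of the ansatz.
  have hB : coeffB s a α - Complex.I
      = -Complex.I * (2 * a + Complex.I + s * 2 * Complex.I * α * a) / (a + Complex.I) := by
    unfold coeffB
    have : (1 + a * Complex.I) / (1 + (a : ℂ) ^ 2) = Complex.I / (a + Complex.I) := by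
      rw [div_eq_div_iff ha1 hc0]
      linear_combination (a : ℂ) * Complex.I_sq
    rw [this]
    field_simp
    ring
  have h := hasFinitePartLine_sum_rotatedKernel (c := a + Complex.I)
    (β := 2 * a + Complex.I + s * 2 * Complex.I * α * a)
    (by simpa using ha) (by simp) (fun h => hs ?_) hB
    (fun k => abs_angleDiff_lt M k m)
    (x := fun k => x k * Complex.exp (Complex.I * angleDiff M k m)) ?_
  · convert h using 1
    rw [Finset.mul_sum, Finset.mul_sum]
    refine Finset.sum_congr rfl fun k _ => ?_
    have e : Complex.exp (Complex.I * angleDiff M k m) * Complex.exp (-Complex.I * angleDiff M k m)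
        = 1 := by
      rw [← Complex.exp_add]; simp
    rw [sidedWeight_sub_I_div_sinh, mul_assoc (x k), ← mul_assoc (Complex.exp _), e, one_mul]
    change Real.pi * Complex.I / a * (a ^ 2 * (s * 2 * Complex.I * α + 1) / (a + Complex.I) ^ 2
      * (sidedWeight (angleDiff M k m) (coeffB s a α) / Complex.sinh (Real.pi * coeffB s a α))
      * x k) = _
    generalize sidedWeight (angleDiff M k m) (coeffB s a α)
      / Complex.sinh (Real.pi * coeffB s a α) = w
    field_simp
    ring
  -- Imaginary parts of `β = 2c` read `1 + 2saα = 2`, the excluded resonance.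
  · have := congrArg Complex.im h
    simp at this
    linarith
  · have e : ∀ k : Fin M, x k * Complex.exp (Complex.I * angleDiff M k m)
        * Complex.exp (-2 * Complex.I * angleDiff M k m)
        = Complex.exp (Complex.I * angle M m) * (x k * Complex.exp (-Complex.I * angle M k)) := by
      intro k
      rw [mul_assoc, ← Complex.exp_add, mul_left_comm, ← Complex.exp_add]
      congr 2
      unfold angleDiff
      push_cast
      ring
    simp only [e]
    rw [← Finset.mul_sum, hx, mul_zero]

/-- The action of `H_m` on the ansatz. -/
theorem hasLinBROperator_ansatz_iff {M : ℕ} (hM : 3 ≤ M) {a μ g α : ℝ} (ha : 0 < a) (hg : g ≠ 0)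
    (hα : 0 < α) (hα' : α ≠ 1 / (2 * a)) {X Y : Fin M → ℝ → ℂ} {t : ℝ} (ht : 0 < t)
    (hX : ∑ k, X k t * Complex.exp (-Complex.I * angle M k) = 0)
    (hY : ∑ k, Y k t * Complex.exp (-Complex.I * angle M k) = 0) (m : Fin M) (θ : ℝ) (h : ℂ) :
    HasLinBROperator a g M (fun k φ => ansatz a μ g α M X Y k t φ) m θ h ↔
      h = Complex.exp (-Complex.I * θ) *
        (mode 1 a μ g α M m t θ * (c0 a g M * X m t - g * ∑ k, cmk 1 a α M m k * X k t)
          + mode (-1) a μ g α M m t θ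
            * (c0 a g M * Y m t - g * ∑ k, cmk (-1) a α M m k * Y k t)) := by
  have ha0 : (a : ℂ) ≠ 0 := by exact_mod_cast ha.ne'
  have hc0 := ofReal_add_I_ne_zero a
  have hpi : (Real.pi : ℂ) ≠ 0 := by exact_mod_cast Real.pi_ne_zero
  have hp : 2 * a * α * 1 ≠ 1 := by
    intro h
    apply hα'
    field_simp
    linarith
  have hn : 2 * a * α * (-1) ≠ 1 := by
    have : 0 < a * α := mul_pos ha hα
    intro h
    nlinarith
  have h0 := (hasFinitePartLine_self hM ha m).const_mul
    (Complex.exp (-2 * Complex.I * θ) * ansatz a μ g α M X Y m t θ)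
  have h1 := (hasFinitePartLine_mode (s := 1) ha hp m hX).const_mul
    (-(Complex.exp (-Complex.I * θ) * mode 1 a μ g α M m t θ))
  have h2 := (hasFinitePartLine_mode (s := -1) ha hn m hY).const_mul
    (-(Complex.exp (-Complex.I * θ) * mode (-1) a μ g α M m t θ))
  have hall := ((h0.add h1).add h2).congr
    (G := linBRIntegrand a M (fun k φ => ansatz a μ g α M X Y k t φ) m θ) ?_
  · have hkey : ∀ L : ℂ, HasFinitePartLine
        (linBRIntegrand a M (fun k φ => ansatz a μ g α M X Y k t φ) m θ) 0 L ↔ L = _ :=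
      fun L => ⟨fun hL => hL.unique hall, fun hL => hL ▸ hall⟩
    have hang : Complex.exp (-2 * Complex.I * θ) * Complex.exp (Complex.I * θ)
        = Complex.exp (-Complex.I * θ) := by
      rw [← Complex.exp_add]; congr 1; ring
    unfold HasLinBROperator
    simp only [hkey, exists_eq_left]
    rw [← hang]
    refine Eq.congr_right ?_
    unfold ansatz c0
    generalize Complex.cosh (Real.pi * coeffA a / M) / Complex.sinh (Real.pi * coeffA a / M) = w
    generalize Complex.exp (-2 * Complex.I * θ) = e₂
    generalize Complex.exp (Complex.I * θ) = e₁
    field_simp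
    ring
  · intro σ
    simp only [linBRIntegrand, Finset.mul_sum, ← Finset.sum_add_distrib]
    refine Finset.sum_congr rfl fun k _ => ?_
    have e1 : ∀ s : ℝ, Complex.exp ((2 * a + Complex.I + s * 2 * Complex.I * α * a) * σ)
        = Complex.exp (2 * a * σ) * Complex.exp (Complex.I * σ)
          * Complex.exp (s * Complex.I * α * (2 * a * σ)) := by
      intro s
      rw [← Complex.exp_add, ← Complex.exp_add]
      congr 1
      ring
    have e2 : Complex.exp (Complex.I * (σ + θ + angleDiff M k m : ℝ))
        = Complex.exp (Complex.I * σ) * Complex.exp (Complex.I * θ)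
          * Complex.exp (Complex.I * angleDiff M k m) := by
      rw [← Complex.exp_add, ← Complex.exp_add]
      congr 1
      push_cast
      ring
    have e3 : Complex.exp (-Complex.I * θ)
        = Complex.exp (-2 * Complex.I * θ) * Complex.exp (Complex.I * θ) := by
      rw [← Complex.exp_add]; congr 1; ring
    rw [e1, e1, e3]
    simp only [ansatz]
    rw [mode_shift hg 1 k m ht, mode_shift hg (-1) k m ht, e2]
    ring

/-! ### Separation of the modes -/

/-- This is why the equation for `X` involves the conjugate of `Y` and conversely. -/
theorem conj_mode {a μ g α : ℝ} (s : ℝ) {M : ℕ} (m : Fin M) (t θ : ℝ) :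
    conj (mode s a μ g α M m t θ) = mode (-s) a μ g α M m t θ := by
  unfold mode
  rw [← Complex.exp_conj]
  congr 1
  simp only [map_mul, Complex.conj_ofReal, Complex.conj_I]
  push_cast
  ring

/-- The functions `ζ_m^+` and `ζ_m^-` of `θ` are linearly independent. -/
theorem forall_mode_combination_eq_zero_iff {a μ g α : ℝ} (ha : a ≠ 0) (hg : g ≠ 0) (hα : α ≠ 0)
    {M : ℕ} (m : Fin M) {t : ℝ} (ht : 0 < t) (u w : ℂ) :
    (∀ θ : ℝ, mode 1 a μ g α M m t θ * u + mode (-1) a μ g α M m t θ * w = 0) ↔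
      u = 0 ∧ w = 0 := by
  refine ⟨fun h => ?_, by rintro ⟨rfl, rfl⟩; simp⟩
  have key : ∀ φ : ℝ, Complex.exp (Complex.I * φ) * u + Complex.exp (-(Complex.I * φ)) * w = 0 := by
    intro φ
    -- This `θ` makes the phase of the positive mode equal to `φ`.
    have hθ := h (angle M m + (φ / α - (2 * μ - 1) * Real.log t) / (2 * a))
    have hα' : (α : ℂ) ≠ 0 := by exact_mod_cast hα
    have ha' : (a : ℂ) ≠ 0 := by exact_mod_cast ha
    rw [mode_eq _ a μ g α hg M m t _ ht, mode_eq _ a μ g α hg M m t _ ht] at hθ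
    convert hθ using 4
    · push_cast
      field_simp
      ring
    · push_cast
      field_simp
      ring
  have h0 := key 0
  have h1 := key (Real.pi / 2)
  have e : Complex.exp (Complex.I * (Real.pi / 2 : ℝ)) = Complex.I := by
    rw [mul_comm]; push_cast; exact Complex.exp_pi_div_two_mul_I
  rw [Complex.exp_neg, e, Complex.inv_I] at h1
  simp at h0
  have hw : w = -u := by linear_combination h0
  rw [hw] at h1
  have : u = 0 := by
    have h2 : Complex.I * (2 * u) = 0 := by linear_combination h1
    simpa using h2
  exact ⟨this, by rw [hw, this, neg_zero]⟩

theorem hasDerivAt_mode_time {a μ g α : ℝ} (hg : g ≠ 0) (s : ℝ) {M : ℕ} (m : Fin M) {t : ℝ}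
    (ht : 0 < t) (θ : ℝ) :
    HasDerivAt (fun τ => mode s a μ g α M m τ θ)
      (mode s a μ g α M m t θ * (s * Complex.I * α * ((2 * μ - 1) / t))) t := by
  have h1 : HasDerivAt (fun τ : ℝ => 2 * a * (θ - angle M m) + (2 * μ - 1) * Real.log τ)
      ((2 * μ - 1) * t⁻¹) t := ((Real.hasDerivAt_log ht.ne').const_mul _).const_add _
  have h2 := (h1.ofReal_comp.const_mul (s * Complex.I * α)).cexp
  rw [← mode_eq s a μ g α hg M m t θ ht] at h2
  refine (h2.congr_of_eventuallyEq ?_).congr_deriv ?_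
  · filter_upwards [lt_mem_nhds ht] with τ hτ
    exact mode_eq s a μ g α hg M m τ θ hτ
  · push_cast
    rw [div_eq_mul_inv]

theorem hasDerivAt_mode_angle {a μ g α : ℝ} (hg : g ≠ 0) (s : ℝ) {M : ℕ} (m : Fin M) {t : ℝ}
    (ht : 0 < t) (θ : ℝ) :
    HasDerivAt (fun φ => mode s a μ g α M m t φ)
      (mode s a μ g α M m t θ * (s * Complex.I * α * (2 * a))) θ := by
  have h1 : HasDerivAt (fun φ : ℝ => 2 * a * (φ - angle M m) + (2 * μ - 1) * Real.log t)
      (2 * a * 1) θ := (((hasDerivAt_id θ).sub_const _).const_mul _).add_const _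
  have h2 := (h1.ofReal_comp.const_mul (s * Complex.I * α)).cexp
  rw [← mode_eq s a μ g α hg M m t θ ht] at h2
  refine (h2.congr_of_eventuallyEq (.of_forall fun φ => ?_)).congr_deriv ?_
  · exact mode_eq s a μ g α hg M m t φ ht
  · push_cast
    ring

theorem hasDerivAt_ansatz_time {a μ g α : ℝ} (hg : g ≠ 0) {M : ℕ} {X Y : Fin M → ℝ → ℂ}
    (m : Fin M) {t : ℝ} (ht : 0 < t) (hX : DifferentiableAt ℝ (X m) t)
    (hY : DifferentiableAt ℝ (Y m) t) (θ : ℝ) :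
    HasDerivAt (fun τ => ansatz a μ g α M X Y m τ θ)
      (Complex.exp (Complex.I * θ) *
        (mode 1 a μ g α M m t θ
          * (deriv (X m) t + Complex.I * α * ((2 * μ - 1) / t) * X m t)
        + mode (-1) a μ g α M m t θ
          * (deriv (Y m) t - Complex.I * α * ((2 * μ - 1) / t) * Y m t))) t := by
  have h1 := (hX.hasDerivAt.mul
    (hasDerivAt_mode_time (a := a) (μ := μ) (α := α) hg 1 m ht θ)).mul_const
    (Complex.exp (Complex.I * θ))
  have h2 := (hY.hasDerivAt.mul
    (hasDerivAt_mode_time (a := a) (μ := μ) (α := α) hg (-1) m ht θ)).mul_const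
    (Complex.exp (Complex.I * θ))
  refine (h1.add h2).congr_deriv ?_
  push_cast
  ring

theorem hasDerivAt_ansatz_angle {a μ g α : ℝ} (hg : g ≠ 0) {M : ℕ} {X Y : Fin M → ℝ → ℂ}
    (m : Fin M) {t : ℝ} (ht : 0 < t) (θ : ℝ) :
    HasDerivAt (fun φ => ansatz a μ g α M X Y m t φ)
      (Complex.exp (Complex.I * θ) *
        (mode 1 a μ g α M m t θ * (Complex.I * (2 * a * α + 1) * X m t)
        + mode (-1) a μ g α M m t θ * (Complex.I * (-(2 * a * α) + 1) * Y m t))) θ := by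
  have h0 : HasDerivAt (fun φ : ℝ => Complex.exp (Complex.I * φ))
      (Complex.exp (Complex.I * θ) * (Complex.I * 1)) θ := by
    simpa using ((hasDerivAt_id θ).ofReal_comp.const_mul Complex.I).cexp
  have h1 := ((hasDerivAt_mode_angle (a := a) (μ := μ) (α := α) hg 1 m ht θ).const_mul
    (X m t)).mul h0
  have h2 := ((hasDerivAt_mode_angle (a := a) (μ := μ) (α := α) hg (-1) m ht θ).const_mul
    (Y m t)).mul h0
  refine (h1.add h2).congr_deriv ?_
  push_cast
  ring

end AlexanderSpiral

end

/-! ### The equivalence with the system of ordinary differential equations -/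

open AlexanderSpiral
theorem proposition1p2 (M : ℕ) (hM : 3 ≤ M) (a μ g α : ℝ) (ha : 0 < a) (hg : g ≠ 0)
    (hα : 0 < α) (hα' : α ≠ 1 / (2 * a))
    (X Y : Fin M → ℝ → ℂ)
    (hX : ∀ m, ContDiffOn ℝ ∞ (X m) (Set.Ioi 0))
    (hY : ∀ m, ContDiffOn ℝ ∞ (Y m) (Set.Ioi 0))
    (hX1 : ∀ t : ℝ, 0 < t → ∑ k, X k t * Complex.exp (-Complex.I * angle M k) = 0)
    (hY1 : ∀ t : ℝ, 0 < t → ∑ k, Y k t * Complex.exp (-Complex.I * angle M k) = 0)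
    (hX2 : ∀ t : ℝ, 0 < t → ∑ k, X k t * Complex.exp (-2 * Complex.I * angle M k) = 0)
    (hY2 : ∀ t : ℝ, 0 < t → ∑ k, Y k t * Complex.exp (-2 * Complex.I * angle M k) = 0) :
    SolvesLinearizedBR a μ g M (ansatz a μ g α M X Y) ↔
      ∀ (m : Fin M) (t : ℝ), 0 < t →
        ((t : ℂ) * deriv (X m) t + Complex.I * ((1 - 2 * μ) / (2 * a)) * X m t
            = -conj (c0 a g M) * conj (Y m t)
              + g * ∑ k, conj (cmk (-1) a α M m k) * conj (Y k t)) ∧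
        ((t : ℂ) * deriv (Y m) t + Complex.I * ((1 - 2 * μ) / (2 * a)) * Y m t
            = -conj (c0 a g M) * conj (X m t)
              + g * ∑ k, conj (cmk 1 a α M m k) * conj (X k t)) := by
  have hdiff : ∀ Z : ℝ → ℂ, ContDiffOn ℝ ∞ Z (Set.Ioi 0) → ∀ t, 0 < t → DifferentiableAt ℝ Z t :=
    fun Z hZ t ht => (hZ.differentiableOn (by simp)).differentiableAt (Ioi_mem_nhds ht)
  refine forall_congr' fun m => forall_congr' fun t => forall_congr' fun ht => ?_
  have hT := hasDerivAt_ansatz_time (a := a) (μ := μ) (α := α) hg m ht (hdiff _ (hX m) t ht)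
    (hdiff _ (hY m) t ht)
  have hΘ := hasDerivAt_ansatz_angle (a := a) (μ := μ) (α := α) (X := X) (Y := Y) hg m ht
  have ha0 : (a : ℂ) ≠ 0 := by exact_mod_cast ha.ne'
  have ht0 : (t : ℂ) ≠ 0 := by exact_mod_cast ht.ne'
  -- The two equations become the vanishing of the coefficients of the two modes, hence one identity
  -- for all `θ`, to be compared pointwise with the conjugated equation.
  rw [← sub_eq_zero (a := (t : ℂ) * deriv (X m) t + _),
    ← sub_eq_zero (a := (t : ℂ) * deriv (Y m) t + _),
    ← forall_mode_combination_eq_zero_iff (μ := μ) ha.ne' hg hα.ne' m ht]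
  refine forall_congr' fun θ => ?_
  simp only [(hT θ).differentiableAt, (hΘ θ).differentiableAt, true_and,
    hasLinBROperator_ansatz_iff hM ha hg hα hα' ht (hX1 t ht) (hY1 t ht), exists_eq_left]
  have hT' : deriv (fun τ => conj (ansatz a μ g α M X Y m τ θ)) t = conj _ := (hT θ).star.deriv
  have hΘ' : deriv (fun φ => conj (ansatz a μ g α M X Y m t φ)) θ = conj _ := (hΘ θ).star.deriv
  have hexp : conj (Complex.exp (-Complex.I * θ)) = Complex.exp (Complex.I * θ) := by
    rw [← Complex.exp_conj]; simp
  rw [hT', hΘ', ← (starRingEnd ℂ).injective.eq_iff, ← sub_eq_zero]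
  refine Iff.trans (Eq.congr_left ?_)
    (mul_eq_zero_iff_left (Complex.exp_ne_zero (Complex.I * θ)))
  simp only [map_sub, map_mul, map_add, map_neg, map_sum, Complex.conj_conj, Complex.conj_ofReal,
    hexp, conj_mode, neg_neg, map_div₀, map_one, map_ofNat]
  field_simp
  ring
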